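/- Let $k\ge 1$ be an integer, $\lambda_1>k-1$ a rational number and $p_1,\dots,p_{k-1}\ge 0$ integers; put $\lambda_{j+1}=\lambda_j+p_j-1$ for $1\le j\le k-1$. *The algebra.* For a commutative $\mathbb C$-algebra $R$ let $\tilde{\mathcal A}_R$ be the $b$-completion of $R\langle a,b\rangle/(ab-ba-b^2)$; its elements are the series $\sum_{n\ge 0}b^nP_n(a)$ with $P_n\in R[a]$, and it contains $R[[b]]$. Put $\tilde{\mathcal A}=\tilde{\mathcal A}_{\mathbb C}$. *The parameter space.* For $1\le j\le k-1$ let $V_j\subset\mathbb C[[b]]$ be spanned by $1,b,\dots,b^{k-j-1}$ and, if $p_j+\dots+p_{k-1}\ge k-j$, also by $b^{q_j}$, where $q_j=p_j+\dots+p_{j+h}$ with $h\ge 0$ minimal such that $q_j\ge k-j$. Let $\mathcal S=\mathcal S(\lambda_1,p_1,\dots,p_{k-1})$ be the set of $\sigma=(S_1,\dots,S_{k-1})$ with $S_j\in V_j$, $S_j(0)=1$, and the coefficient of $b^{p_j}$ in $S_j$ nonzero, for all $j$. The coefficients of the $S_j$ other than the constant ones identify $\mathcal S$ with an open subset of an affine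 space, hence with a complex manifold. For $\sigma\in\mathcal S$ put $$P(\sigma)=(a-\lambda_1b)S_1^{-1}(a-\lambda_2b)S_2^{-1}\cdots S_{k-1}^{-1}(a-\lambda_kb),\qquad E(\sigma)=\tilde{\mathcal A}/\tilde{\mathcal A}\,P(\sigma),$$ and let $\mathbb E$ be the presheaf $V\mapsto\tilde{\mathcal A}_{\mathcal O(V)}/\tilde{\mathcal A}_{\mathcal O(V)}P$ on $\mathcal S$, where $P$ is the operator above with the tautological series $S_j\in\mathcal O(V)[[b]]$. *Holomorphic families of themes.* On a complex manifold $X$, a sheaf of $\mathcal O_X$-$(a,b)$-modules is a locally free sheaf of finite type of $\mathcal O_X[[b]]$-modules with an $\mathcal O_X$-linear, $b$-adically continuous sheaf endomorphism $a$ such that $ab-ba=b^2$. For a finite set $\Lambda\subset\,]0,1]\cap\mathbb Q$ and $N\ge 0$ let $\Xi_{X,\Lambda}^{(N)}=\bigoplus_{\lambda\in\Lambda}\bigoplus_{j=0}^N\mathcal O_X[[b]]\,e_{\lambda,j}$ with $a\,e_{\lambda,0}=\lambda b\,e_{\lambda,0}$ and $a\,e_{\lambda,j}=\lambda b\,e_{\lambda,j}+b\,e_{\lambda,j-1}$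 for $j\ge1$; let $\Xi_\Lambda^{(N)}$ be the same module over $\mathbb C[[b]]$. A holomorphic map $\varphi:U\to\Xi_\Lambda^{(N)}$ on an open set $U$ (that is, a section over $U$ of $\Xi_{X,\Lambda}^{(N)}$) is $k$-thematic if the subsheaf $\mathbb E_\varphi$ of $\mathcal O_U[[b]]$-modules generated by the $a^\nu\varphi$, $\nu\ge 0$, is free with basis $\varphi,a\varphi,\dots,a^{k-1}\varphi$, and for each $x\in U$ the values $\varphi(x),\dots,a^{k-1}\varphi(x)$ are linearly independent over $\mathbb C[[b]]$ (so that the fibre of $\mathbb E_\varphi$ at $x$ is the rank $k$ theme $\tilde{\mathcal A}\varphi(x)\subset\Xi_\Lambda^{(N)}$). A sheaf of $\mathcal O_X$-$(a,b)$-modules is a holomorphic family of rank $k$ themes if $X$ is covered by open sets $U$ on each of which it is isomorphic to $\mathbb E_\varphi$ for some finite $\Lambda\subset\,]0,1]\cap\mathbb Q$ and some $k$-thematic holomorphic map $\varphi:U\to\Xi_\Lambda^{(k-1)}$. **Theorem.** The canonical family is holomorphic. Precisely: 1. up to a permutation of the coordinates, $\mathcal S=\mathbb C^m\times(\mathbb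 C^*)^n$ for some $m,n\ge 0$; 2. $\mathbb E$ is a sheaf of $\mathcal O_{\mathcal S}$-$(a,b)$-modules; 3. for each $\sigma\in\mathcal S$, the fibre $\mathbb E/\mathcal M_\sigma[[b]]\,\mathbb E$ of $\mathbb E$ at $\sigma$ is $E(\sigma)$ (where $\mathcal M_\sigma$ is the ideal of holomorphic functions vanishing at $\sigma$, and $\mathcal M_\sigma[[b]]$ consists of the series with coefficients in $\mathcal M_\sigma$), and $E(\sigma)$ is a $[\lambda_1]$-primitive theme of rank $k$: it is free of rank $k$ over $\mathbb C[[b]]$, generated by one element, and embeds, compatibly with $a$ and $b$, in some $\Xi_{\{\lambda\}}^{(N)}$ with $\lambda\in\,]0,1]$, $\lambda\equiv\lambda_1 \bmod \mathbb Z$; 4. $\mathbb E$ is a holomorphic family of rank $k$ themes. -/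

import Mathlib

open scoped Manifold ContDiff PowerSeries

namespace ABTheme

/-! ### The algebra `Ã` over a commutative ring -/

/-- The `b`-completion `Ã_R` of the `R`-algebra `R⟨a, b⟩ / (a b - b a - b²)`. Its elements are the
series `∑ b ^ n P_n(a)` with arbitrary polynomials `P_n ∈ R[a]`; the series is stored as the power
series in `b` with coefficients `P_n`, the powers of `b` standing on the left. -/
@[ext]
structure ATilde (R : Type*) [CommRing R] where
  /-- the power series in `b` with coefficients in `R[a]` -/
  series : PowerSeries (Polynomial R)

/-- Left multiplication by `a`: since `a b ^ n = b ^ n a + n b ^ (n + 1)`, it is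
"multiply the coefficients by `a`" plus `b² d/db`. -/
noncomputable def leftA (R : Type*) [CommRing R] :
    Module.End R (PowerSeries (Polynomial R)) where
  toFun u := PowerSeries.C (Polynomial.X : Polynomial R) * u +
    PowerSeries.X ^ 2 * PowerSeries.derivative (Polynomial R) u
  map_add' u v := by rw [map_add]; ring
  map_smul' r u := by
    have h : ∀ w : PowerSeries (Polynomial R), r • w = PowerSeries.C (Polynomial.C r) * w := by
      intro w
      ext n : 1
      rw [PowerSeries.coeff_C_mul, ← Polynomial.smul_eq_C_mul]
      rfl
    simp only [h, Derivation.leibniz, RingHom.id_apply, PowerSeries.derivative_C, smul_eq_mul]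
    ring

theorem coeff_leftA_zero {R : Type*} [CommRing R] (u : PowerSeries (Polynomial R)) :
    PowerSeries.coeff 0 (leftA R u) = Polynomial.X * PowerSeries.coeff 0 u := by
  simp [leftA, pow_two, mul_assoc]

theorem coeff_leftA_succ {R : Type*} [CommRing R] (u : PowerSeries (Polynomial R)) (n : ℕ) :
    PowerSeries.coeff (n + 1) (leftA R u) =
      Polynomial.X * PowerSeries.coeff (n + 1) u + (n : Polynomial R) * PowerSeries.coeff n u := by
  simp only [leftA, LinearMap.coe_mk, AddHom.coe_mk, map_add, PowerSeries.coeff_C_mul, pow_two,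
    mul_assoc, PowerSeries.coeff_succ_X_mul]
  cases n with
  | zero => simp
  | succ m => rw [PowerSeries.coeff_succ_X_mul, PowerSeries.coeff_derivative]; push_cast; ring

/-- The product of `Ã_R`: `(∑ b ^ i P_i(a)) * v = ∑ b ^ i P_i(a) v`, where `P_i(a) v` is computed
with left multiplication by `a`. -/
noncomputable def mulSeries {R : Type*} [CommRing R] (u v : PowerSeries (Polynomial R)) :
    PowerSeries (Polynomial R) :=
  PowerSeries.mk fun n => ∑ ij ∈ Finset.HasAntidiagonal.antidiagonal n,
    PowerSeries.coeff ij.2 (Polynomial.aeval (leftA R) (PowerSeries.coeff ij.1 u) v)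

theorem coeff_mulSeries {R : Type*} [CommRing R] (u v : PowerSeries (Polynomial R)) (n : ℕ) :
    PowerSeries.coeff n (mulSeries u v) = ∑ ij ∈ Finset.HasAntidiagonal.antidiagonal n,
      PowerSeries.coeff ij.2 (Polynomial.aeval (leftA R) (PowerSeries.coeff ij.1 u) v) :=
  PowerSeries.coeff_mk _ _

theorem mulSeries_add {R : Type*} [CommRing R] (u v w : PowerSeries (Polynomial R)) :
    mulSeries u (v + w) = mulSeries u v + mulSeries u w := by
  ext n : 1
  simp [coeff_mulSeries, Finset.sum_add_distrib]

theorem add_mulSeries {R : Type*} [CommRing R] (u v w : PowerSeries (Polynomial R)) :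
    mulSeries (u + v) w = mulSeries u w + mulSeries v w := by
  ext n : 1
  simp [coeff_mulSeries, Finset.sum_add_distrib]

theorem smul_mulSeries {R : Type*} [CommRing R] (r : R) (u w : PowerSeries (Polynomial R)) :
    mulSeries (r • u) w = r • mulSeries u w := by
  ext n : 1
  simp only [coeff_mulSeries, PowerSeries.coeff_smul, map_smul, LinearMap.smul_apply,
    Finset.smul_sum]

theorem leftA_mulSeries {R : Type*} [CommRing R] (u w : PowerSeries (Polynomial R)) :
    mulSeries (leftA R u) w = leftA R (mulSeries u w) := by
  ext n : 1
  cases n with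
  | zero => simp [coeff_mulSeries, coeff_leftA_zero]
  | succ n =>
    rw [coeff_leftA_succ, coeff_mulSeries, coeff_mulSeries, coeff_mulSeries]
    have h1 : ∀ ij : ℕ × ℕ,
        PowerSeries.coeff ij.2 (Polynomial.aeval (leftA R) (PowerSeries.coeff ij.1 (leftA R u)) w)
        = PowerSeries.coeff ij.2 (leftA R (Polynomial.aeval (leftA R) (PowerSeries.coeff ij.1 u) w))
        + (match ij.1 with
          | 0 => 0
          | i + 1 => (i : Polynomial R) * PowerSeries.coeff ij.2
              (Polynomial.aeval (leftA R) (PowerSeries.coeff i u) w)) := by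
      rintro ⟨i, j⟩
      cases i with
      | zero => simp [coeff_leftA_zero]
      | succ i =>
        have h3 : ∀ y : PowerSeries (Polynomial R), PowerSeries.coeff j ((i : PowerSeries
            (Polynomial R)) * y) = (i : Polynomial R) * PowerSeries.coeff j y := by
          intro y
          rw [← nsmul_eq_mul, ← nsmul_eq_mul, map_nsmul]
        simp [coeff_leftA_succ, h3]
    have h2 : ∀ ij : ℕ × ℕ,
        PowerSeries.coeff ij.2 (leftA R (Polynomial.aeval (leftA R) (PowerSeries.coeff ij.1 u) w))
        = Polynomial.X * PowerSeries.coeff ij.2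
            (Polynomial.aeval (leftA R) (PowerSeries.coeff ij.1 u) w)
        + (match ij.2 with
          | 0 => 0
          | j + 1 => (j : Polynomial R) * PowerSeries.coeff j
              (Polynomial.aeval (leftA R) (PowerSeries.coeff ij.1 u) w)) := by
      rintro ⟨i, j⟩
      cases j with
      | zero => simp [coeff_leftA_zero]
      | succ j => rw [coeff_leftA_succ]
    rw [Finset.sum_congr rfl fun ij _ => h1 ij, Finset.sum_add_distrib,
      Finset.sum_congr rfl fun ij _ => h2 ij, Finset.sum_add_distrib, ← Finset.mul_sum, add_assoc]
    congr 1
    rw [Finset.Nat.sum_antidiagonal_succ', Finset.Nat.sum_antidiagonal_succ]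
    simp only [zero_add]
    rw [← Finset.sum_add_distrib, Finset.mul_sum]
    refine Finset.sum_congr rfl fun ij hij => ?_
    rw [Finset.HasAntidiagonal.mem_antidiagonal] at hij
    rw [← hij]
    push_cast
    ring

theorem aeval_mulSeries {R : Type*} [CommRing R] (P : Polynomial R)
    (u w : PowerSeries (Polynomial R)) :
    mulSeries (Polynomial.aeval (leftA R) P u) w =
      Polynomial.aeval (leftA R) P (mulSeries u w) := by
  induction P using Polynomial.induction_on' generalizing u with
  | add p q hp hq => simp [add_mulSeries, hp, hq]
  | monomial n r =>
    have hpow : ∀ m : ℕ, mulSeries ((leftA R ^ m) u) w = (leftA R ^ m) (mulSeries u w) := by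
      intro m
      induction m with
      | zero => simp
      | succ m ih => rw [pow_succ', Module.End.mul_apply, Module.End.mul_apply, leftA_mulSeries, ih]
    simp only [Polynomial.aeval_monomial, Module.End.mul_apply, Module.algebraMap_end_apply,
      smul_mulSeries, hpow]

theorem mulSeries_assoc {R : Type*} [CommRing R] (u v w : PowerSeries (Polynomial R)) :
    mulSeries (mulSeries u v) w = mulSeries u (mulSeries v w) := by
  ext n : 1
  rw [coeff_mulSeries, coeff_mulSeries]
  simp only [← aeval_mulSeries]
  simp only [coeff_mulSeries, map_sum, LinearMap.sum_apply]
  rw [Finset.sum_sigma', Finset.sum_sigma']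
  refine Finset.sum_nbij' (fun x => ⟨(x.2.1, x.2.2 + x.1.2), (x.2.2, x.1.2)⟩)
    (fun x => ⟨(x.1.1 + x.2.1, x.2.2), (x.1.1, x.2.1)⟩) ?_ ?_ ?_ ?_ ?_
  all_goals
    rintro ⟨⟨i, j⟩, ⟨k, l⟩⟩ h
    simp only [Finset.mem_sigma, Finset.HasAntidiagonal.mem_antidiagonal] at h ⊢
  · exact ⟨by omega, trivial⟩
  · exact ⟨by omega, trivial⟩
  · obtain ⟨-, rfl⟩ := h
    rfl
  · obtain ⟨-, rfl⟩ := h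
    rfl

end ABTheme

namespace ABTheme

theorem one_mulSeries {R : Type*} [CommRing R] (u : PowerSeries (Polynomial R)) :
    mulSeries 1 u = u := by
  ext n : 1
  rw [coeff_mulSeries, Finset.sum_eq_single (0, n)]
  · simp
  · rintro ⟨i, j⟩ h1 h2
    have hi : i ≠ 0 := by
      rintro rfl
      rw [Finset.HasAntidiagonal.mem_antidiagonal] at h1
      simp_all
    simp [PowerSeries.coeff_one, hi]
  · intro h
    simp at h

theorem aeval_leftA_C {R : Type*} [CommRing R] (P Q : Polynomial R) :
    Polynomial.aeval (leftA R) P (PowerSeries.C Q) = PowerSeries.C (P * Q) := by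
  induction P using Polynomial.induction_on' with
  | add p q hp hq => simp [add_mul, hp, hq]
  | monomial n r =>
    have hpow : ∀ m : ℕ,
        (leftA R ^ m) (PowerSeries.C Q) = PowerSeries.C (Polynomial.X ^ m * Q) := by
      intro m
      induction m with
      | zero => simp
      | succ m ih =>
        rw [pow_succ', Module.End.mul_apply, ih, pow_succ', mul_assoc]
        simp [leftA]
    rw [Polynomial.aeval_monomial, Module.End.mul_apply, hpow, Module.algebraMap_end_apply,
      ← Polynomial.C_mul_X_pow_eq_monomial, mul_assoc]
    ext m : 1
    rw [PowerSeries.coeff_smul, PowerSeries.coeff_C, PowerSeries.coeff_C]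
    split_ifs
    · rw [Polynomial.smul_eq_C_mul]
    · simp

theorem mulSeries_one {R : Type*} [CommRing R] (u : PowerSeries (Polynomial R)) :
    mulSeries u 1 = u := by
  ext n : 1
  rw [coeff_mulSeries, Finset.sum_eq_single (n, 0)]
  · rw [← map_one PowerSeries.C, aeval_leftA_C]
    simp
  · rintro ⟨i, j⟩ h1 h2
    have hj : j ≠ 0 := by
      rintro rfl
      rw [Finset.HasAntidiagonal.mem_antidiagonal] at h1
      simp_all
    rw [← map_one PowerSeries.C, aeval_leftA_C]
    simp [PowerSeries.coeff_C, hj]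
  · intro h
    simp at h

noncomputable instance (R : Type*) [CommRing R] : Zero (ATilde R) := ⟨⟨0⟩⟩
noncomputable instance (R : Type*) [CommRing R] : One (ATilde R) := ⟨⟨1⟩⟩
noncomputable instance (R : Type*) [CommRing R] : Add (ATilde R) :=
  ⟨fun u v => ⟨u.series + v.series⟩⟩
noncomputable instance (R : Type*) [CommRing R] : Neg (ATilde R) := ⟨fun u => ⟨-u.series⟩⟩
noncomputable instance (R : Type*) [CommRing R] : Mul (ATilde R) :=
  ⟨fun u v => ⟨mulSeries u.series v.series⟩⟩

noncomputable instance (R : Type*) [CommRing R] : Ring (ATilde R) :=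
  Ring.ofMinimalAxioms
    (fun u v w => ATilde.ext (add_assoc u.series v.series w.series))
    (fun u => ATilde.ext (zero_add u.series))
    (fun u => ATilde.ext (neg_add_cancel u.series))
    (fun u v w => ATilde.ext (mulSeries_assoc u.series v.series w.series))
    (fun u => ATilde.ext (one_mulSeries u.series))
    (fun u => ATilde.ext (mulSeries_one u.series))
    (fun u v w => ATilde.ext (mulSeries_add u.series v.series w.series))
    (fun u v w => ATilde.ext (add_mulSeries u.series v.series w.series))

namespace ATilde

theorem series_add {R : Type*} [CommRing R] (u v : ATilde R) :
    (u + v).series = u.series + v.series := rfl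

theorem series_mul {R : Type*} [CommRing R] (u v : ATilde R) :
    (u * v).series = mulSeries u.series v.series := rfl

/-- The generator `a`. -/
noncomputable def a (R : Type*) [CommRing R] : ATilde R := ⟨PowerSeries.C Polynomial.X⟩

/-- The generator `b`. -/
noncomputable def b (R : Type*) [CommRing R] : ATilde R := ⟨PowerSeries.X⟩

/-- Left multiplication by a series `f(b)` is the multiplication of power series in `b`. -/
theorem mulSeries_map_C {R : Type*} [CommRing R] (f : PowerSeries R)
    (u : PowerSeries (Polynomial R)) :
    mulSeries (PowerSeries.map Polynomial.C f) u = PowerSeries.map Polynomial.C f * u := by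
  ext n : 1
  rw [coeff_mulSeries, PowerSeries.coeff_mul]
  refine Finset.sum_congr rfl fun ij _ => ?_
  rw [PowerSeries.coeff_map, Polynomial.aeval_C, Module.algebraMap_end_apply,
    PowerSeries.coeff_smul, Polynomial.smul_eq_C_mul]

/-- The inclusion of the commutative subalgebra `R[[b]]` into `Ã_R`. -/
noncomputable def ofSeries (R : Type*) [CommRing R] : PowerSeries R →+* ATilde R where
  toFun f := ⟨PowerSeries.map Polynomial.C f⟩
  map_one' := ATilde.ext (map_one (PowerSeries.map (Polynomial.C : R →+* Polynomial R)))
  map_zero' := ATilde.ext (map_zero (PowerSeries.map (Polynomial.C : R →+* Polynomial R)))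
  map_add' f g := ATilde.ext (map_add (PowerSeries.map (Polynomial.C : R →+* Polynomial R)) f g)
  map_mul' f g := ATilde.ext <| by rw [series_mul, mulSeries_map_C, map_mul]

theorem series_ofSeries_mul {R : Type*} [CommRing R] (f : PowerSeries R) (u : ATilde R) :
    (ofSeries R f * u).series = PowerSeries.map Polynomial.C f * u.series :=
  mulSeries_map_C f u.series

theorem ofSeries_X {R : Type*} [CommRing R] : ofSeries R PowerSeries.X = b R :=
  ATilde.ext (PowerSeries.map_X (Polynomial.C : R →+* Polynomial R))

theorem series_b_mul {R : Type*} [CommRing R] (u : ATilde R) :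
    (b R * u).series = PowerSeries.X * u.series := by
  rw [← ofSeries_X, series_ofSeries_mul, PowerSeries.map_X]

theorem series_a_mul {R : Type*} [CommRing R] (u : ATilde R) :
    (a R * u).series = leftA R u.series := by
  rw [series_mul]
  ext n : 1
  rw [coeff_mulSeries, Finset.sum_eq_single (0, n)]
  · simp [a]
  · rintro ⟨i, j⟩ h1 h2
    have hi : i ≠ 0 := by
      rintro rfl
      rw [Finset.HasAntidiagonal.mem_antidiagonal] at h1
      simp_all
    simp [a, PowerSeries.coeff_C, hi]
  · intro h
    simp at h

/-- The defining relation `a b - b a = b²`. -/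
theorem a_mul_b_sub {R : Type*} [CommRing R] : a R * b R - b R * a R = b R ^ 2 := by
  rw [sub_eq_iff_eq_add, pow_two]
  refine ATilde.ext ?_
  rw [series_add, series_a_mul, series_b_mul, series_b_mul]
  simp only [leftA, a, b, LinearMap.coe_mk, AddHom.coe_mk, PowerSeries.derivative_X]
  ring

/-- Functoriality of `Ã_R` in `R`: apply a ring homomorphism to all coefficients. -/
noncomputable def map {R R' : Type*} [CommRing R] [CommRing R'] (g : R →+* R') :
    ATilde R →+* ATilde R' where
  toFun u := ⟨PowerSeries.map (Polynomial.mapRingHom g) u.series⟩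
  map_one' := ATilde.ext (map_one (PowerSeries.map (Polynomial.mapRingHom g)))
  map_zero' := ATilde.ext (map_zero (PowerSeries.map (Polynomial.mapRingHom g)))
  map_add' u v :=
    ATilde.ext (map_add (PowerSeries.map (Polynomial.mapRingHom g)) u.series v.series)
  map_mul' u v := by
    have hA : ∀ w : PowerSeries (Polynomial R),
        PowerSeries.map (Polynomial.mapRingHom g) (leftA R w) =
          leftA R' (PowerSeries.map (Polynomial.mapRingHom g) w) := by
      intro w
      ext n : 1
      cases n with
      | zero => rw [PowerSeries.coeff_map, coeff_leftA_zero, coeff_leftA_zero]; simp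
      | succ n => rw [PowerSeries.coeff_map, coeff_leftA_succ, coeff_leftA_succ]; simp
    have hs : ∀ (r : R) (w : PowerSeries (Polynomial R)),
        PowerSeries.map (Polynomial.mapRingHom g) (r • w) =
          g r • PowerSeries.map (Polynomial.mapRingHom g) w := by
      intro r w
      ext n : 1
      rw [PowerSeries.coeff_map, PowerSeries.coeff_smul, PowerSeries.coeff_smul,
        PowerSeries.coeff_map, Polynomial.smul_eq_C_mul, Polynomial.smul_eq_C_mul, map_mul]
      simp
    have hP : ∀ (P : Polynomial R) (w : PowerSeries (Polynomial R)),
        PowerSeries.map (Polynomial.mapRingHom g) (Polynomial.aeval (leftA R) P w) =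
          Polynomial.aeval (leftA R') (Polynomial.mapRingHom g P)
            (PowerSeries.map (Polynomial.mapRingHom g) w) := by
      intro P w
      induction P using Polynomial.induction_on' with
      | add p q hp hq => simp only [map_add, LinearMap.add_apply, hp, hq]
      | monomial n r =>
        have hpow : ∀ m : ℕ, PowerSeries.map (Polynomial.mapRingHom g) ((leftA R ^ m) w) =
            (leftA R' ^ m) (PowerSeries.map (Polynomial.mapRingHom g) w) := by
          intro m
          induction m with
          | zero => simp
          | succ m ih =>
            rw [pow_succ', Module.End.mul_apply, hA, ih, pow_succ', Module.End.mul_apply]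
        rw [Polynomial.coe_mapRingHom, Polynomial.map_monomial, Polynomial.aeval_monomial,
          Polynomial.aeval_monomial, Module.End.mul_apply, Module.End.mul_apply,
          Module.algebraMap_end_apply, Module.algebraMap_end_apply, hs, hpow]
    refine ATilde.ext ?_
    rw [series_mul, series_mul]
    ext n : 1
    rw [PowerSeries.coeff_map, coeff_mulSeries, coeff_mulSeries, map_sum]
    refine Finset.sum_congr rfl fun ij _ => ?_
    rw [← PowerSeries.coeff_map, hP, PowerSeries.coeff_map]

theorem map_a {R R' : Type*} [CommRing R] [CommRing R'] (g : R →+* R') :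
    map g (a R) = a R' :=
  ATilde.ext <| (PowerSeries.map_C (Polynomial.mapRingHom g) Polynomial.X).trans <| by simp [a]

theorem map_ofSeries {R R' : Type*} [CommRing R] [CommRing R'] (g : R →+* R')
    (f : PowerSeries R) : map g (ofSeries R f) = ofSeries R' (PowerSeries.map g f) := by
  refine ATilde.ext (PowerSeries.ext fun n => ?_)
  simp [map, ofSeries]

theorem map_b {R R' : Type*} [CommRing R] [CommRing R'] (g : R →+* R') :
    map g (b R) = b R' := by
  rw [← ofSeries_X, map_ofSeries, PowerSeries.map_X, ofSeries_X]

end ATilde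

end ABTheme

namespace ABTheme

open TopologicalSpace

/-! ### The cyclic left modules `Ã_R / Ã_R P` -/

/-- The left `Ã_R`-module `Ã_R / Ã_R P` (in Mathlib `Ideal` means left ideal). -/
abbrev Cyc (R : Type*) [CommRing R] (P : ATilde R) : Type _ :=
  ATilde R ⧸ (Ideal.span {P} : Ideal (ATilde R))

noncomputable instance (R : Type*) [CommRing R] (P : ATilde R) :
    Module (PowerSeries R) (Cyc R P) :=
  Module.compHom (Cyc R P) (ATilde.ofSeries R)

/-- The action of `a` on `Ã_R / Ã_R P`. -/
noncomputable def Cyc.aAct {R : Type*} [CommRing R] (P : ATilde R) : Cyc R P →+ Cyc R P :=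
  smulAddHom (ATilde R) (Cyc R P) (ATilde.a R)

/-- The map `Ã_R / Ã_R P → Ã_R' / Ã_R' P'` induced by a ring homomorphism that sends `P` to
`P'`. -/
noncomputable def Cyc.map {R R' : Type*} [CommRing R] [CommRing R'] (g : R →+* R')
    {P : ATilde R} {P' : ATilde R'} (h : ATilde.map g P = P') : Cyc R P →+ Cyc R' P' :=
  (Submodule.mapQ (Ideal.span {P} : Ideal (ATilde R)) (Ideal.span {P'} : Ideal (ATilde R'))
    (ATilde.map g).toSemilinearMap (by
      rw [Ideal.span, Submodule.span_le, Set.singleton_subset_iff]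
      change ATilde.map g P ∈ Ideal.span {P'}
      rw [h]
      exact Ideal.subset_span rfl)).toAddMonoidHom

/-- `thetaP lam S n = (a - λ₁ b) S₁⁻¹ (a - λ₂ b) S₂⁻¹ ⋯ Sₙ⁻¹ (a - λₙ₊₁ b)`. Here every `S_j` is a
series with constant term `1`, and `PowerSeries.invOfUnit S_j 1` is its inverse. -/
noncomputable def thetaP {R : Type*} [CommRing R] [Algebra ℂ R] (lam : ℕ → ℚ)
    (S : ℕ → PowerSeries R) : ℕ → ATilde R
  | 0 => ATilde.a R - ATilde.ofSeries R (PowerSeries.C (algebraMap ℂ R (lam 1 : ℂ))) * ATilde.b R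
  | n + 1 => thetaP lam S n * ATilde.ofSeries R (PowerSeries.invOfUnit (S (n + 1)) 1) *
      (ATilde.a R -
        ATilde.ofSeries R (PowerSeries.C (algebraMap ℂ R (lam (n + 2) : ℂ))) * ATilde.b R)

theorem map_invOfUnit {R R' : Type*} [CommRing R] [CommRing R'] (g : R →+* R')
    (f : PowerSeries R) (hf : PowerSeries.constantCoeff f = 1) :
    PowerSeries.map g (PowerSeries.invOfUnit f 1) =
      PowerSeries.invOfUnit (PowerSeries.map g f) 1 := by
  have h1 : f * PowerSeries.invOfUnit f 1 = 1 := PowerSeries.mul_invOfUnit f 1 (by simpa using hf)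
  have h2 : PowerSeries.map g f * PowerSeries.invOfUnit (PowerSeries.map g f) 1 = 1 :=
    PowerSeries.mul_invOfUnit _ 1 (by
      rw [← PowerSeries.coeff_zero_eq_constantCoeff_apply, PowerSeries.coeff_map,
        PowerSeries.coeff_zero_eq_constantCoeff_apply, hf]
      simp)
  have h3 : PowerSeries.map g f * PowerSeries.map g (PowerSeries.invOfUnit f 1) = 1 := by
    rw [← map_mul, h1, map_one]
  exact (left_inv_eq_right_inv ((mul_comm _ _).trans h2) h3).symm

theorem map_thetaP {R R' : Type*} [CommRing R] [CommRing R'] [Algebra ℂ R] [Algebra ℂ R']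
    (g : R →ₐ[ℂ] R') (lam : ℕ → ℚ) (S : ℕ → PowerSeries R)
    (hS : ∀ j, PowerSeries.constantCoeff (S j) = 1) (n : ℕ) :
    ATilde.map (g : R →+* R') (thetaP lam S n) =
      thetaP lam (fun j => PowerSeries.map (g : R →+* R') (S j)) n := by
  induction n with
  | zero =>
    simp only [thetaP, map_sub, map_mul, ATilde.map_a, ATilde.map_b, ATilde.map_ofSeries,
      PowerSeries.map_C, RingHom.coe_coe, AlgHom.commutes]
  | succ n ih =>
    simp only [thetaP, map_sub, map_mul, ATilde.map_a, ATilde.map_b, ATilde.map_ofSeries,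
      PowerSeries.map_C, RingHom.coe_coe, AlgHom.commutes, ih, map_invOfUnit _ _ (hS _)]

/-! ### Holomorphic functions and sheaves of `(a,b)`-modules on a complex manifold -/

/-- The ring `𝒪_X(V)` of holomorphic functions on an open subset `V` of a complex manifold `X`. -/
abbrev Hol (E : Type*) {X : Type*} [NormedAddCommGroup E] [NormedSpace ℂ E] [TopologicalSpace X]
    [ChartedSpace E X] (V : Opens X) : Type _ :=
  C^ω⟮𝓘(ℂ, E), V; 𝓘(ℂ, ℂ), ℂ⟯

/-- The ring `𝒪_X(V)[[b]]`. -/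
abbrev HolB (E : Type*) {X : Type*} [NormedAddCommGroup E] [NormedSpace ℂ E] [TopologicalSpace X]
    [ChartedSpace E X] (V : Opens X) : Type _ :=
  PowerSeries (Hol E V)

/-- Restriction of holomorphic functions. -/
noncomputable def Hol.res (E : Type*) {X : Type*} [NormedAddCommGroup E] [NormedSpace ℂ E]
    [TopologicalSpace X] [ChartedSpace E X] {V W : Opens X} (h : W ≤ V) :
    Hol E V →ₐ[ℂ] Hol E W :=
  { ContMDiffMap.restrictRingHom 𝓘(ℂ, E) 𝓘(ℂ, ℂ) ℂ h with
    commutes' := fun _ => rfl }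

/-- Evaluation of holomorphic functions at a point. -/
noncomputable def Hol.eval (E : Type*) {X : Type*} [NormedAddCommGroup E] [NormedSpace ℂ E]
    [TopologicalSpace X] [ChartedSpace E X] {V : Opens X} (x : V) : Hol E V →ₐ[ℂ] ℂ where
  toFun f := f x
  map_one' := rfl
  map_mul' _ _ := rfl
  map_zero' := rfl
  map_add' _ _ := rfl
  commutes' _ := rfl

/-- Restriction `𝒪_X(V)[[b]] → 𝒪_X(W)[[b]]`, coefficient by coefficient. -/
noncomputable def HolB.res {E X : Type*} [NormedAddCommGroup E] [NormedSpace ℂ E]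
    [TopologicalSpace X] [ChartedSpace E X] {V W : Opens X} (h : W ≤ V) :
    HolB E V →+* HolB E W :=
  PowerSeries.map (Hol.res E h : Hol E V →+* Hol E W)

/-- Evaluation `𝒪_X(V)[[b]] → ℂ[[b]]` at a point, coefficient by coefficient. -/
noncomputable def HolB.eval {E X : Type*} [NormedAddCommGroup E] [NormedSpace ℂ E]
    [TopologicalSpace X] [ChartedSpace E X] {V : Opens X} (x : V) :
    HolB E V →+* PowerSeries ℂ :=
  PowerSeries.map (Hol.eval E x : Hol E V →+* ℂ)

/-- The data of a presheaf of `𝒪_X[[b]]`-modules with an operator `a`. The conditions that make it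
a sheaf of `𝒪_X`-`(a,b)`-modules are stated in `IsABSheaf`. -/
structure ABPresheaf (E X : Type) [NormedAddCommGroup E] [NormedSpace ℂ E] [TopologicalSpace X]
    [ChartedSpace E X] where
  /-- the sections over an open set -/
  obj : Opens X → Type
  [grp : ∀ V, AddCommGroup (obj V)]
  [mod : ∀ V, Module (HolB E V) (obj V)]
  /-- the operator `a` -/
  aMap : ∀ V, obj V →+ obj V
  /-- the restriction maps -/
  res : ∀ {V W : Opens X}, W ≤ V → obj V →+ obj W

attribute [instance] ABPresheaf.grp ABPresheaf.mod

/-- A sheaf of `𝒪_X`-`(a,b)`-modules: a locally free sheaf of finite type of `𝒪_X[[b]]`-modules with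
an `𝒪_X`-linear, `b`-adically continuous sheaf map `a` such that `a b - b a = b²`. -/
structure IsABSheaf {E X : Type} [NormedAddCommGroup E] [NormedSpace ℂ E] [TopologicalSpace X]
    [ChartedSpace E X] (F : ABPresheaf E X) : Prop where
  res_self : ∀ (V : Opens X) (s : F.obj V), F.res le_rfl s = s
  res_res : ∀ {U V W : Opens X} (h : V ≤ U) (h' : W ≤ V) (s : F.obj U),
    F.res h' (F.res h s) = F.res (h'.trans h) s
  res_smul : ∀ {V W : Opens X} (h : W ≤ V) (f : HolB E V) (s : F.obj V),
    F.res h (f • s) = HolB.res h f • F.res h s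
  /-- sections that agree locally are equal -/
  separated : ∀ (V : Opens X) (s t : F.obj V),
    (∀ x ∈ V, ∃ (W : Opens X) (h : W ≤ V), x ∈ W ∧ F.res h s = F.res h t) → s = t
  /-- compatible sections glue -/
  glue : ∀ {I : Type} (U : I → Opens X) (s : ∀ i, F.obj (U i)),
    (∀ i j, F.res (inf_le_left : U i ⊓ U j ≤ U i) (s i) =
      F.res (inf_le_right : U i ⊓ U j ≤ U j) (s j)) →
    ∃ t : F.obj (iSup U), ∀ i, F.res (le_iSup U i) t = s i
  /-- locally, there is a finite basis -/
  locally_free : ∀ x : X, ∃ (U : Opens X) (r : ℕ) (e : Fin r → F.obj U), x ∈ U ∧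
    ∀ (V : Opens X) (h : V ≤ U), LinearIndependent (HolB E V) (fun i => F.res h (e i)) ∧
      Submodule.span (HolB E V) (Set.range fun i => F.res h (e i)) = ⊤
  /-- `a` is a map of sheaves -/
  res_aMap : ∀ {V W : Opens X} (h : W ≤ V) (s : F.obj V),
    F.res h (F.aMap V s) = F.aMap W (F.res h s)
  /-- `a` is `𝒪_X`-linear -/
  aMap_C_smul : ∀ (V : Opens X) (f : Hol E V) (s : F.obj V),
    F.aMap V ((PowerSeries.C f : HolB E V) • s) = (PowerSeries.C f : HolB E V) • F.aMap V s
  /-- `a` is continuous for the `b`-adic topology -/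
  aMap_continuous : ∀ (V : Opens X) (n : ℕ), ∃ m : ℕ, ∀ s : F.obj V, ∃ t : F.obj V,
    F.aMap V ((PowerSeries.X ^ m : HolB E V) • s) = (PowerSeries.X ^ n : HolB E V) • t
  /-- `a b - b a = b²` -/
  aMap_b : ∀ (V : Opens X) (s : F.obj V),
    F.aMap V ((PowerSeries.X : HolB E V) • s) - (PowerSeries.X : HolB E V) • F.aMap V s =
      (PowerSeries.X ^ 2 : HolB E V) • s

/-- The `ℂ[[b]]`-module `M` with the operator `aM` is the fibre `F(x) = F / 𝓜_x[[b]] F` at `x`: there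
is an evaluation map `ev` from the germs of sections of `F` at `x` onto `M`, compatible with
evaluation `𝒪_X[[b]] → ℂ[[b]]` at `x` and with `a`, whose kernel consists of the germs in
`𝓜_x[[b]] F`, where `𝓜_x[[b]]` consists of the series all of whose coefficients vanish at `x`. -/
def IsFibre {E X : Type} [NormedAddCommGroup E] [NormedSpace ℂ E] [TopologicalSpace X]
    [ChartedSpace E X] (F : ABPresheaf E X) (x : X) (M : Type) [AddCommGroup M]
    [Module (PowerSeries ℂ) M] (aM : M →+ M) : Prop :=
  ∃ ev : ∀ V : Opens X, x ∈ V → (F.obj V →+ M),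
    (∀ (V W : Opens X) (h : W ≤ V) (hx : x ∈ W) (s : F.obj V),
      ev W hx (F.res h s) = ev V (h hx) s) ∧
    (∀ (V : Opens X) (hx : x ∈ V) (f : HolB E V) (s : F.obj V),
      ev V hx (f • s) = HolB.eval (⟨x, hx⟩ : V) f • ev V hx s) ∧
    (∀ (V : Opens X) (hx : x ∈ V) (s : F.obj V), ev V hx (F.aMap V s) = aM (ev V hx s)) ∧
    (∀ m : M, ∃ (V : Opens X) (hx : x ∈ V) (s : F.obj V), ev V hx s = m) ∧
    (∀ (V : Opens X) (hx : x ∈ V) (s : F.obj V), ev V hx s = 0 ↔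
      ∃ (W : Opens X) (h : W ≤ V) (hxW : x ∈ W),
        F.res h s ∈ RingHom.ker (HolB.eval (E := E) (⟨x, hxW⟩ : W)) •
          (⊤ : Submodule (HolB E W) (F.obj W)))

/-! ### The modules `Ξ_Λ^{(N)}`, themes and thematic maps -/

/-- `Ξ_Λ^{(N)} = ⊕_{λ ∈ Λ} ⊕_{j ≤ N} R[[b]] e_{λ,j}`; an element is the family of its
coordinates. -/
abbrev Xi (R : Type*) [CommRing R] (Λ : Finset ℚ) (N : ℕ) : Type _ :=
  Λ × Fin (N + 1) → PowerSeries R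

/-- The operator `a` on `Ξ_Λ^{(N)}`, given by `a e_{λ,0} = λ b e_{λ,0}`,
`a e_{λ,j} = λ b e_{λ,j} + b e_{λ,j-1}` for `j ≥ 1`, and `a f(b) = f(b) a + b² f'(b)`. -/
noncomputable def Xi.aMap {R : Type*} [CommRing R] [Algebra ℂ R] {Λ : Finset ℚ} {N : ℕ}
    (v : Xi R Λ N) : Xi R Λ N := fun i =>
  PowerSeries.X ^ 2 * PowerSeries.derivative R (v i) +
    PowerSeries.C (algebraMap ℂ R (((i.1 : ℚ)) : ℂ)) * PowerSeries.X * v i +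
    PowerSeries.X * (if h : (i.2 : ℕ) + 1 < N + 1 then v (i.1, ⟨(i.2 : ℕ) + 1, h⟩) else 0)

/-- Change of coefficients on `Ξ_Λ^{(N)}`. -/
noncomputable def Xi.map {R R' : Type*} [CommRing R] [CommRing R'] {Λ : Finset ℚ} {N : ℕ}
    (g : R →+* R') (v : Xi R Λ N) : Xi R' Λ N := fun i => PowerSeries.map g (v i)

/-- The `R[[b]]`-submodule generated by the `a^ν φ`, `ν ∈ ℕ`. -/
noncomputable def Xi.orbitSpan {R : Type*} [CommRing R] [Algebra ℂ R] {Λ : Finset ℚ} {N : ℕ}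
    (φ : Xi R Λ N) : Submodule (PowerSeries R) (Xi R Λ N) :=
  Submodule.span (PowerSeries R) (Set.range fun ν : ℕ => Xi.aMap^[ν] φ)

theorem Xi.map_aMap {R R' : Type*} [CommRing R] [CommRing R'] [Algebra ℂ R] [Algebra ℂ R']
    {Λ : Finset ℚ} {N : ℕ} (g : R →ₐ[ℂ] R') (v : Xi R Λ N) :
    Xi.map (g : R →+* R') (Xi.aMap v) = Xi.aMap (Xi.map (g : R →+* R') v) := by
  have hd : ∀ f : PowerSeries R, PowerSeries.map (g : R →+* R') (PowerSeries.derivative R f) =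
      PowerSeries.derivative R' (PowerSeries.map (g : R →+* R') f) := by
    intro f
    ext n
    simp [PowerSeries.coeff_derivative]
  funext i
  simp only [Xi.map, Xi.aMap, map_add, map_mul, map_pow, PowerSeries.map_X, PowerSeries.map_C, hd,
    RingHom.coe_coe, AlgHom.commutes]
  split_ifs <;> simp

theorem Xi.map_orbitSpan {R R' : Type*} [CommRing R] [CommRing R'] [Algebra ℂ R] [Algebra ℂ R']
    {Λ : Finset ℚ} {N : ℕ} (g : R →ₐ[ℂ] R') (φ s : Xi R Λ N) (hs : s ∈ Xi.orbitSpan φ) :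
    Xi.map (g : R →+* R') s ∈ Xi.orbitSpan (Xi.map (g : R →+* R') φ) := by
  induction hs using Submodule.span_induction with
  | mem x hx =>
    obtain ⟨ν, rfl⟩ := hx
    refine Submodule.subset_span ⟨ν, ?_⟩
    exact ((Function.Semiconj.iterate_right (f := Xi.map (g : R →+* R'))
      (fun v => Xi.map_aMap g v) ν) φ).symm
  | zero =>
    have : Xi.map (g : R →+* R') (0 : Xi R Λ N) = 0 := by funext i; simp [Xi.map]
    rw [this]
    exact Submodule.zero_mem _
  | add x y _ _ hx hy =>
    have : Xi.map (g : R →+* R') (x + y) = Xi.map (g : R →+* R') x + Xi.map (g : R →+* R') y := by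
      funext i; simp [Xi.map]
    rw [this]
    exact Submodule.add_mem _ hx hy
  | smul f x _ hx =>
    have : Xi.map (g : R →+* R') (f • x) =
        PowerSeries.map (g : R →+* R') f • Xi.map (g : R →+* R') x := by
      funext i; simp [Xi.map]
    rw [this]
    exact Submodule.smul_mem _ _ hx

/-- Restriction of sections of the sheaf `Ξ_{X,Λ}^{(N)}`. -/
noncomputable def Xi.res {E X : Type*} [NormedAddCommGroup E] [NormedSpace ℂ E]
    [TopologicalSpace X] [ChartedSpace E X] {Λ : Finset ℚ} {N : ℕ} {V W : Opens X} (h : W ≤ V)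
    (v : Xi (Hol E V) Λ N) : Xi (Hol E W) Λ N :=
  Xi.map (Hol.res E h : Hol E V →+* Hol E W) v

/-- The sections over `V ⊆ U` of the subsheaf `𝔼_φ` of `𝒪_X[[b]]`-modules of `Ξ_{X,Λ}^{(N)}` generated
by the `a^ν φ`, `ν ∈ ℕ`, where `φ` is a holomorphic map `U → Ξ_Λ^{(N)}`, i.e. a section of
`Ξ_{X,Λ}^{(N)}` over `U`: the sections that are locally `𝒪_X[[b]]`-combinations of the `a^ν φ`. -/
noncomputable def genSheaf {E X : Type*} [NormedAddCommGroup E] [NormedSpace ℂ E]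
    [TopologicalSpace X] [ChartedSpace E X] {Λ : Finset ℚ} {N : ℕ} {U : Opens X}
    (φ : Xi (Hol E U) Λ N) (V : Opens X) (hV : V ≤ U) :
    Submodule (HolB E V) (Xi (Hol E V) Λ N) where
  carrier := {s | ∀ x ∈ V, ∃ (W : Opens X) (h : W ≤ V), x ∈ W ∧
    Xi.res h s ∈ Xi.orbitSpan (Xi.res (h.trans hV) φ)}
  zero_mem' := by
    intro x hx
    refine ⟨V, le_rfl, hx, ?_⟩
    have : Xi.res (le_rfl : V ≤ V) (0 : Xi (Hol E V) Λ N) = 0 := by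
      funext i; simp [Xi.res, Xi.map]
    rw [this]
    exact Submodule.zero_mem _
  add_mem' := by
    intro s t hs ht x hx
    obtain ⟨W₁, h₁, hx₁, hs₁⟩ := hs x hx
    obtain ⟨W₂, h₂, hx₂, ht₂⟩ := ht x hx
    have key : ∀ (W : Opens X) (h : W ≤ V) (h' : W₁ ⊓ W₂ ≤ W) (u : Xi (Hol E V) Λ N),
        Xi.res h u ∈ Xi.orbitSpan (Xi.res (h.trans hV) φ) →
        Xi.res (h'.trans h) u ∈ Xi.orbitSpan (Xi.res ((h'.trans h).trans hV) φ) := by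
      intro W h h' u hu
      have := Xi.map_orbitSpan (Hol.res E h') _ _ hu
      have hc : ∀ {V' : Opens X} (hh : W ≤ V') (v : Xi (Hol E V') Λ N),
          Xi.map (Hol.res E h' : Hol E W →+* Hol E (W₁ ⊓ W₂ : Opens X)) (Xi.res hh v) =
            Xi.res (h'.trans hh) v := by
        intro V' hh v
        funext i
        ext n
        simp only [Xi.map, Xi.res, PowerSeries.coeff_map]
        rfl
      rwa [hc, hc] at this
    refine ⟨W₁ ⊓ W₂, inf_le_left.trans h₁, ⟨hx₁, hx₂⟩, ?_⟩
    have : Xi.res (inf_le_left.trans h₁ : W₁ ⊓ W₂ ≤ V) (s + t) =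
        Xi.res (inf_le_left.trans h₁ : W₁ ⊓ W₂ ≤ V) s +
          Xi.res (inf_le_left.trans h₁ : W₁ ⊓ W₂ ≤ V) t := by
      funext i; simp [Xi.res, Xi.map]
    rw [this]
    exact Submodule.add_mem _ (key W₁ h₁ inf_le_left s hs₁) (key W₂ h₂ inf_le_right t ht₂)
  smul_mem' := by
    intro f s hs x hx
    obtain ⟨W, h, hxW, hsW⟩ := hs x hx
    refine ⟨W, h, hxW, ?_⟩
    have : Xi.res h (f • s) = HolB.res h f • Xi.res h s := by
      funext i; simp [Xi.res, Xi.map, HolB.res]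
    rw [this]
    exact Submodule.smul_mem _ _ hsW

/-- A holomorphic map `φ : U → Ξ_Λ^{(N)}` is `k`-thematic: the sheaf `𝔼_φ` is free of rank `k` on
`𝒪_X[[b]]` with basis `φ, aφ, …, a^{k-1}φ`, and for each `x ∈ U` the fibre of `𝔼_φ` at `x` is
`Ã φ(x) ⊆ Ξ_Λ^{(N)}`, a theme of rank `k` (the values `φ(x), aφ(x), …, a^{k-1}φ(x)` are independent
on `ℂ[[b]]`). -/
structure IsThematic {E X : Type*} [NormedAddCommGroup E] [NormedSpace ℂ E]
    [TopologicalSpace X] [ChartedSpace E X] {Λ : Finset ℚ} {N : ℕ} {U : Opens X} (k : ℕ)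
    (φ : Xi (Hol E U) Λ N) : Prop where
  linearIndependent : ∀ (V : Opens X) (h : V ≤ U),
    LinearIndependent (HolB E V) (fun i : Fin k => Xi.aMap^[(i : ℕ)] (Xi.res h φ))
  span_eq : ∀ (V : Opens X) (h : V ≤ U),
    Submodule.span (HolB E V) (Set.range fun i : Fin k => Xi.aMap^[(i : ℕ)] (Xi.res h φ)) =
      genSheaf φ V h
  fibre : ∀ x : U, LinearIndependent (PowerSeries ℂ)
    (fun i : Fin k => Xi.aMap^[(i : ℕ)] (Xi.map (Hol.eval E x : Hol E U →+* ℂ) φ))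

/-- A holomorphic family of rank `k` themes: near every point `F` is isomorphic, as a sheaf of
`𝒪_X`-`(a,b)`-modules, to `𝔼_φ` for a `k`-thematic holomorphic map `φ` to some `Ξ_Λ^{(k-1)}` with
`Λ ⊆ ]0,1] ∩ ℚ` finite. The isomorphism is given as an injective morphism to `Ξ_{X,Λ}^{(k-1)}` with
image `𝔼_φ`. -/
def IsHolomorphicFamilyOfThemes {E X : Type} [NormedAddCommGroup E] [NormedSpace ℂ E]
    [TopologicalSpace X] [ChartedSpace E X] (k : ℕ) (F : ABPresheaf E X) : Prop :=
  ∀ x : X, ∃ (U : Opens X) (Λ : Finset ℚ) (φ : Xi (Hol E U) Λ (k - 1))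
    (θ : ∀ V : Opens X, V ≤ U → (F.obj V →ₗ[HolB E V] Xi (Hol E V) Λ (k - 1))),
    x ∈ U ∧ (∀ l ∈ Λ, 0 < l ∧ l ≤ 1) ∧ IsThematic k φ ∧
    (∀ (V : Opens X) (hV : V ≤ U), Function.Injective (θ V hV) ∧
      LinearMap.range (θ V hV) = genSheaf φ V hV) ∧
    (∀ (V : Opens X) (hV : V ≤ U) (s : F.obj V), θ V hV (F.aMap V s) = Xi.aMap (θ V hV s)) ∧
    (∀ (V W : Opens X) (hV : V ≤ U) (h : W ≤ V) (s : F.obj V),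
      θ W (h.trans hV) (F.res h s) = Xi.res h (θ V hV s))

/-- The `ℂ[[b]]`-module `M` with the operator `aM` is a `[λ₁]`-primitive theme of rank `k`: it is free
of rank `k` on `ℂ[[b]]`, generated by one element as an `(a,b)`-module, and it embeds in some
`Ξ_λ^{(N)}` with `λ ∈ ]0,1]`, `λ ∈ λ₁ + ℤ`. -/
def IsPrimitiveTheme (lam1 : ℚ) (k : ℕ) (M : Type) [AddCommGroup M] [Module (PowerSeries ℂ) M]
    (aM : M →+ M) : Prop :=
  Nonempty (Module.Basis (Fin k) (PowerSeries ℂ) M) ∧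
  (∃ e : M, Submodule.span (PowerSeries ℂ) (Set.range fun ν : ℕ => aM^[ν] e) = ⊤) ∧
  ∃ (l : ℚ) (N : ℕ) (θ : M →ₗ[PowerSeries ℂ] Xi ℂ {l} N), 0 < l ∧ l ≤ 1 ∧
    (∃ m : ℤ, lam1 = l + m) ∧ Function.Injective θ ∧ ∀ m : M, θ (aM m) = Xi.aMap (θ m)

/-! ### The parameter space -/

/-- The exponents of the basis of `V_j`, for `1 ≤ j ≤ k - 1`: these are `0, …, k - j - 1` and, if
`p_j + ⋯ + p_{k-1} ≥ k - j`, also `q_j = p_j + ⋯ + p_{j+h}` with `h` minimal such that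
`q_j ≥ k - j`. -/
noncomputable def expV (k : ℕ) (p : ℕ → ℕ) (j : ℕ) : Finset ℕ :=
  if ∑ i ∈ Finset.Icc j (k - 1), p i < k - j then Finset.range (k - j)
  else insert (∑ i ∈ Finset.Icc j (j + sInf {h | k - j ≤ ∑ i ∈ Finset.Icc j (j + h), p i}), p i)
    (Finset.range (k - j))

/-- The parameter space `𝒮(λ₁, p₁, …, p_{k-1})` (it does not depend on `λ₁`): the families
`(S_1, …, S_{k-1})` with `S_j ∈ V_j`, `S_j(0) = 1` and nonzero coefficient of `b ^ p_j`. -/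
def paramSpace (k : ℕ) (p : ℕ → ℕ) : Set (Finset.Icc 1 (k - 1) → PowerSeries ℂ) :=
  {S | ∀ j : Finset.Icc 1 (k - 1), S j ∈ Submodule.span ℂ ((fun n : ℕ => (PowerSeries.X : PowerSeries ℂ) ^ n) ''
      (expV k p j : Set ℕ)) ∧
    PowerSeries.constantCoeff (S j) = 1 ∧ PowerSeries.coeff (p j) (S j) ≠ 0}

/-- The index set of the free coordinates of `𝒮`: the pairs `(j, n)`, with `1 ≤ j ≤ k - 1` and `n ≠ 0`
an exponent of `V_j`. -/
abbrev CoordIdx (k : ℕ) (p : ℕ → ℕ) : Type :=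
  (Finset.Icc 1 (k - 1)).sigma fun j => (expV k p j).erase 0

/-- The series `S_j = 1 + ∑ s_{j,n} b ^ n` with coordinates `s` (equal to `1` for `j` outside
`[1, k - 1]`). -/
noncomputable def seriesOf {k : ℕ} {p : ℕ → ℕ} (s : CoordIdx k p → ℂ) (j : ℕ) : PowerSeries ℂ :=
  PowerSeries.mk fun n => if n = 0 then 1 else
    if h : (⟨j, n⟩ : Σ _ : ℕ, ℕ) ∈ (Finset.Icc 1 (k - 1)).sigma fun j => (expV k p j).erase 0
    then s ⟨⟨j, n⟩, h⟩ else 0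

theorem continuous_coeff_seriesOf {k : ℕ} {p : ℕ → ℕ} (j n : ℕ) :
    Continuous fun s : CoordIdx k p → ℂ => PowerSeries.coeff n (seriesOf s j) := by
  simp only [seriesOf, PowerSeries.coeff_mk]
  split_ifs <;> fun_prop

/-- The parameter space as an open subset of the affine space of its coordinates. -/
def paramOpens (k : ℕ) (p : ℕ → ℕ) : Opens (CoordIdx k p → ℂ) where
  carrier := {s | ∀ j ∈ Finset.Icc 1 (k - 1), PowerSeries.coeff (p j) (seriesOf s j) ≠ 0}
  is_open' := by
    simp only [Set.ofPred_forall]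
    exact isOpen_biInter_finset fun j _ =>
      isOpen_ne_fun (continuous_coeff_seriesOf j (p j)) continuous_const

/-- The coordinates identify `paramOpens k p` with the parameter space. -/
theorem bijOn_seriesOf (k : ℕ) (p : ℕ → ℕ) :
    Set.BijOn (fun (s : CoordIdx k p → ℂ) (j : Finset.Icc 1 (k - 1)) => seriesOf s j)
      (paramOpens k p) (paramSpace k p) := by
  have hspan : ∀ (A : Finset ℕ) (f : PowerSeries ℂ),
      f ∈ Submodule.span ℂ ((fun n : ℕ => (PowerSeries.X : PowerSeries ℂ) ^ n) '' (A : Set ℕ)) ↔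
        ∀ n, n ∉ A → PowerSeries.coeff n f = 0 := by
    intro A f
    constructor
    · intro hf
      induction hf using Submodule.span_induction with
      | mem x hx =>
        obtain ⟨m, hm, rfl⟩ := hx
        intro n hn
        rw [PowerSeries.coeff_X_pow, if_neg]
        rintro rfl
        exact hn hm
      | zero => intro n _; simp
      | add x y _ _ hx hy => intro n hn; simp [hx n hn, hy n hn]
      | smul c x _ hx => intro n hn; simp [hx n hn]
    · intro h
      have : f = ∑ n ∈ A, PowerSeries.coeff n f • (PowerSeries.X : PowerSeries ℂ) ^ n := by
        ext m
        rw [map_sum]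
        simp only [PowerSeries.coeff_smul, PowerSeries.coeff_X_pow, smul_eq_mul, mul_ite, mul_one,
          mul_zero, Finset.sum_ite_eq]
        split_ifs with hm
        · rfl
        · exact h m hm
      rw [this]
      exact Submodule.sum_mem _ fun n hn =>
        Submodule.smul_mem _ _ (Submodule.subset_span ⟨n, hn, rfl⟩)
  have hzero : ∀ j ∈ Finset.Icc 1 (k - 1), 0 ∈ expV k p j := by
    intro j hj
    rw [Finset.mem_Icc] at hj
    unfold expV
    split_ifs
    · rw [Finset.mem_range]; omega
    · rw [Finset.mem_insert, Finset.mem_range]; right; omega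
  refine ⟨?_, ?_, ?_⟩
  · intro s hs j
    refine ⟨?_, ?_, hs j j.2⟩
    · rw [hspan]
      intro n hn
      have hn0 : n ≠ 0 := fun h0 => hn (h0 ▸ hzero j j.2)
      simp only [seriesOf, PowerSeries.coeff_mk, if_neg hn0]
      rw [dif_neg]
      simp [hn]
    · rw [← PowerSeries.coeff_zero_eq_constantCoeff_apply]
      simp [seriesOf]
  · intro s _ t _ hst
    funext ⟨⟨j, n⟩, h⟩
    have h' := Finset.mem_sigma.mp h
    have hn0 : n ≠ 0 := (Finset.mem_erase.mp h'.2).1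
    have := congrArg (PowerSeries.coeff n) (congrFun hst ⟨j, h'.1⟩)
    simpa only [seriesOf, PowerSeries.coeff_mk, if_neg hn0, dif_pos h] using this
  · intro S hS
    have key : ∀ j : Finset.Icc 1 (k - 1), seriesOf (fun i : CoordIdx k p =>
        PowerSeries.coeff i.1.2 (S ⟨i.1.1, (Finset.mem_sigma.mp i.2).1⟩)) j = S j := by
      intro j
      obtain ⟨h1, h2, -⟩ := hS j
      ext n
      simp only [seriesOf, PowerSeries.coeff_mk]
      split_ifs with hn h
      · rw [hn, PowerSeries.coeff_zero_eq_constantCoeff_apply, h2]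
      · rfl
      · refine ((hspan _ _).mp h1 n fun hmem => h ?_).symm
        exact Finset.mem_sigma.mpr ⟨j.2, Finset.mem_erase.mpr ⟨hn, hmem⟩⟩
    refine ⟨_, ?_, funext key⟩
    intro j hj
    have := (hS ⟨j, hj⟩).2.2
    rwa [← key ⟨j, hj⟩] at this

/-! ### The canonical family -/

/-- `λ_1, λ_2, …` with `λ_{j+1} = λ_j + p_j - 1` (the value at `0` is not used). -/
def lamSeq (lam1 : ℚ) (p : ℕ → ℕ) : ℕ → ℚ
  | 0 => lam1
  | 1 => lam1
  | n + 2 => lamSeq lam1 p (n + 1) + p (n + 1) - 1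

/-- `P(σ) = (a - λ₁ b) S₁⁻¹ ⋯ S_{k-1}⁻¹ (a - λ_k b) ∈ Ã`. -/
noncomputable def canonP {k : ℕ} {p : ℕ → ℕ} (lam1 : ℚ) (σ : paramOpens k p) : ATilde ℂ :=
  thetaP (lamSeq lam1 p) (seriesOf (σ : CoordIdx k p → ℂ)) (k - 1)

/-- `E(σ) = Ã / Ã P(σ)`. -/
abbrev canonE {k : ℕ} {p : ℕ → ℕ} (lam1 : ℚ) (σ : paramOpens k p) : Type :=
  Cyc ℂ (canonP lam1 σ)

theorem contMDiff_coeff_seriesOf {k : ℕ} {p : ℕ → ℕ} (V : Opens (paramOpens k p)) (j n : ℕ) :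
    ContMDiff 𝓘(ℂ, CoordIdx k p → ℂ) 𝓘(ℂ, ℂ) ω
      fun x : V => PowerSeries.coeff n (seriesOf (x : paramOpens k p).1 j) := by
  have hval : ContMDiff 𝓘(ℂ, CoordIdx k p → ℂ) 𝓘(ℂ, CoordIdx k p → ℂ) ω
      fun x : V => ((x : paramOpens k p) : CoordIdx k p → ℂ) :=
    contMDiff_subtype_val.comp contMDiff_subtype_val
  simp only [seriesOf, PowerSeries.coeff_mk]
  split_ifs with h1 h2
  · exact contMDiff_const
  · exact (ContinuousLinearMap.proj (R := ℂ) (φ := fun _ : CoordIdx k p => ℂ)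
      ⟨⟨j, n⟩, h2⟩).contMDiff.comp hval
  · exact contMDiff_const

/-- The coefficient of `b ^ n` in `S_j`, as a holomorphic function on `V`. -/
noncomputable def tautCoeff {k : ℕ} {p : ℕ → ℕ} (V : Opens (paramOpens k p)) (j n : ℕ) :
    Hol (CoordIdx k p → ℂ) V :=
  ⟨fun x : V => PowerSeries.coeff n (seriesOf (x : paramOpens k p).1 j),
    contMDiff_coeff_seriesOf V j n⟩

/-- The tautological series `S_j ∈ 𝒪(V)[[b]]` on an open subset `V` of the parameter space. -/
noncomputable def tautSeries {k : ℕ} {p : ℕ → ℕ} (V : Opens (paramOpens k p)) (j : ℕ) :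
    HolB (CoordIdx k p → ℂ) V :=
  PowerSeries.mk (tautCoeff V j)

theorem constantCoeff_tautSeries {k : ℕ} {p : ℕ → ℕ} (V : Opens (paramOpens k p)) (j : ℕ) :
    PowerSeries.constantCoeff (tautSeries V j) = 1 := by
  rw [← PowerSeries.coeff_zero_eq_constantCoeff_apply, tautSeries, PowerSeries.coeff_mk]
  ext x
  change PowerSeries.coeff 0 (seriesOf _ j) = 1
  simp [seriesOf]

/-- The operator `P` with holomorphic coefficients on `V`. -/
noncomputable def canonPOn {k : ℕ} {p : ℕ → ℕ} (lam1 : ℚ) (V : Opens (paramOpens k p)) :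
    ATilde (Hol (CoordIdx k p → ℂ) V) :=
  thetaP (lamSeq lam1 p) (tautSeries V) (k - 1)

theorem map_res_canonPOn {k : ℕ} {p : ℕ → ℕ} (lam1 : ℚ) {V W : Opens (paramOpens k p)}
    (h : W ≤ V) :
    ATilde.map (Hol.res (CoordIdx k p → ℂ) h : Hol (CoordIdx k p → ℂ) V →+* Hol (CoordIdx k p → ℂ) W)
      (canonPOn lam1 V) = canonPOn lam1 W := by
  rw [canonPOn, map_thetaP _ _ _ (constantCoeff_tautSeries V)]
  congr 1

/-- The restriction maps of the canonical family. -/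
noncomputable def canonRes {k : ℕ} {p : ℕ → ℕ} (lam1 : ℚ) {V W : Opens (paramOpens k p)}
    (h : W ≤ V) : Cyc (Hol (CoordIdx k p → ℂ) V) (canonPOn lam1 V) →+
      Cyc (Hol (CoordIdx k p → ℂ) W) (canonPOn lam1 W) :=
  Cyc.map (Hol.res (CoordIdx k p → ℂ) h :
    Hol (CoordIdx k p → ℂ) V →+* Hol (CoordIdx k p → ℂ) W) (map_res_canonPOn lam1 h)

/-- The canonical family as a presheaf on the parameter space:
`V ↦ Ã_{𝒪(V)} / Ã_{𝒪(V)} P`. -/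
noncomputable def canonicalFamily (k : ℕ) (lam1 : ℚ) (p : ℕ → ℕ) :
    ABPresheaf (CoordIdx k p → ℂ) (paramOpens k p) where
  obj V := Cyc (Hol (CoordIdx k p → ℂ) V) (canonPOn lam1 V)
  aMap V := Cyc.aAct (canonPOn lam1 V)
  res h := canonRes lam1 h

end ABTheme

namespace ABTheme
open TopologicalSpace

/-! ### Division in `Ã_R` by an operator that is monic modulo `b` -/

section Division

variable {R : Type*} [CommRing R]

/-! Two bases of the cyclic module carry the proof. Modulo `b` the algebra is the commutative ring
`R[a]` and `P` becomes `a ^ k`, so one can divide by `P` as by a monic polynomial, one power of `b`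
at a time. Hence `1, a, …, a ^ (k - 1)` is a basis over every `R` (`Cyc.powBasis`), and its
coordinates commute with change of `R` (`Cyc.powBasis_repr_map`). In these coordinates the canonical
presheaf is globally `𝒪[[b]] ^ k`, and both the sheaf axioms and the description of the fibres
become coefficientwise statements about holomorphic functions.

The second basis consists of the classes `e_i` of the right factors of `P` (`tailBasis`). It
satisfies `a e_0 = λ_1 b e_0` and `a e_{i+1} = λ_{i+2} b e_{i+1} + S_{i+1} e_i`, so any sequence
with these relations in another `(a,b)`-module defines a morphism (`chainMap`, `chainMap_aAct`).

Such a sequence `ψ_0, …, ψ_{k-1}` is constructed in `Ξ_l` (`exists_chain_coords`). Write `λ_1 = l +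
m` with `0 < l ≤ 1` and `m ≥ k - 1` an integer; then `λ_{i+1} = l + d_i` with integers `d_i ≥ 0`.
Start from `b ^ d_0 e_{l,0}` and solve `(a - λ_{i+2} b) ψ_{i+1} = S_{i+1} ψ_i` coefficient by
coefficient: on `b ^ n` the operator is the scalar `n - d_{i+1}` plus a nilpotent shift, which is
invertible except at the resonance `n = d_{i+1}`. There one more logarithm appears, with coefficient
that of `b ^ (d_{i+1} + 1)` in the leading part of `S_{i+1} ψ_i`. Because `d_{i+1} + 1 = d_i +
p_{i+1}`, the leading part of `ψ_i` is `c_i b ^ d_i`, where `c_i` is the product of the coefficients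
of `b ^ p_t` in `S_t` for `t ≤ i`. These are exactly the coefficients that are nonzero on the
parameter space, so the sequence is triangular and independent, and the morphism is injective.

Only nonzero complex constants are inverted when solving, so the construction works over holomorphic
functions and commutes with restriction and evaluation. Over `ℂ` it embeds each `E(σ)`; over `𝒪` it
identifies the canonical family with `𝔼_φ` for `φ = ψ_{k-1}`. -/

theorem coeff_zero_mulSeries (u v : PowerSeries (Polynomial R)) :
    PowerSeries.coeff 0 (mulSeries u v) =
      PowerSeries.coeff 0 u * PowerSeries.coeff 0 v := by
  have h : ∀ (P : Polynomial R), PowerSeries.coeff 0 (Polynomial.aeval (leftA R) P v) =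
      P * PowerSeries.coeff 0 v := by
    intro P
    induction P using Polynomial.induction_on' with
    | add p q hp hq => simp only [map_add, LinearMap.add_apply, hp, hq, add_mul]
    | monomial n r =>
      have hpow : ∀ m : ℕ, PowerSeries.coeff 0 ((leftA R ^ m) v) =
          Polynomial.X ^ m * PowerSeries.coeff 0 v := by
        intro m
        induction m with
        | zero => simp
        | succ m ih => rw [pow_succ', Module.End.mul_apply, coeff_leftA_zero, ih]; ring
      rw [Polynomial.aeval_monomial, Module.End.mul_apply, Module.algebraMap_end_apply,
        PowerSeries.coeff_smul, hpow, Polynomial.smul_eq_C_mul,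
        ← Polynomial.C_mul_X_pow_eq_monomial, mul_assoc]
  rw [coeff_mulSeries]
  simp [h]

/-- This isolates the only term that involves the `n`-th coefficient of `u`; the rest depends on
earlier coefficients. Division by `v` can therefore proceed recursively in the power of `b`. -/
theorem coeff_mulSeries_eq (u v : PowerSeries (Polynomial R)) (n : ℕ) :
    PowerSeries.coeff n (mulSeries u v) =
      PowerSeries.coeff n u * PowerSeries.coeff 0 v +
      ∑ i ∈ Finset.range n, PowerSeries.coeff (n - i)
        (Polynomial.aeval (leftA R) (PowerSeries.coeff i u) v) := by
  rw [coeff_mulSeries, Finset.Nat.sum_antidiagonal_eq_sum_range_succ_mk, Finset.sum_range_succ,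
    add_comm, Nat.sub_self]
  congr 1
  have := coeff_zero_mulSeries (PowerSeries.C (PowerSeries.coeff n u)) v
  rwa [coeff_mulSeries, Finset.Nat.antidiagonal_zero, Finset.sum_singleton,
    PowerSeries.coeff_zero_C] at this

/-- Division with remainder by an operator that is congruent to `a ^ k` modulo `b`. -/
theorem exists_degree_sub_mulSeries_lt (k : ℕ) (P : PowerSeries (Polynomial R))
    (hP : PowerSeries.coeff 0 P = Polynomial.X ^ k) (u : PowerSeries (Polynomial R)) :
    ∃ q : PowerSeries (Polynomial R), ∀ n m, k ≤ m →
      (PowerSeries.coeff n (u - mulSeries q P)).coeff m = 0 := by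
  nontriviality R
  -- The `n`-th coefficient of the quotient is the Euclidean quotient by `X ^ k` of what remains of
  -- `u` once the contributions of the earlier coefficients are removed.
  let Q : ℕ → Polynomial R := fun n => Nat.strongRec (motive := fun _ => Polynomial R)
    (fun n ih => (PowerSeries.coeff n u - ∑ i ∈ (Finset.range n).attach, PowerSeries.coeff (n - i)
        (Polynomial.aeval (leftA R) (ih i (Finset.mem_range.mp i.2)) P)) /ₘ Polynomial.X ^ k) n
  have hQ : ∀ n, Q n = (PowerSeries.coeff n u - ∑ i ∈ Finset.range n, PowerSeries.coeff (n - i)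
        (Polynomial.aeval (leftA R) (Q i) P)) /ₘ Polynomial.X ^ k := by
    intro n
    rw [← Finset.sum_attach]
    simp only [Q]
    rw [Nat.strongRec]
  refine ⟨PowerSeries.mk Q, fun n m hm => ?_⟩
  rw [map_sub, coeff_mulSeries_eq, hP]
  simp only [PowerSeries.coeff_mk]
  set w := PowerSeries.coeff n u - ∑ i ∈ Finset.range n, PowerSeries.coeff (n - i)
        (Polynomial.aeval (leftA R) (Q i) P) with hw
  have h1 : PowerSeries.coeff n u - (Q n * Polynomial.X ^ k + ∑ i ∈ Finset.range n,
      PowerSeries.coeff (n - i) (Polynomial.aeval (leftA R) (Q i) P)) =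
      w %ₘ Polynomial.X ^ k := by
    have := Polynomial.modByMonic_add_div w (Polynomial.X ^ k : Polynomial R)
    rw [← hQ n] at this
    rw [← eq_sub_iff_add_eq] at this
    rw [this, hw]
    ring
  rw [h1]
  apply Polynomial.coeff_eq_zero_of_degree_lt
  refine (Polynomial.degree_modByMonic_lt _ (Polynomial.monic_X_pow k)).trans_le ?_
  rw [Polynomial.degree_X_pow]
  exact_mod_cast hm

/-- Uniqueness of division: if the earlier coefficients of `q` vanish, the next coefficient of the
product is `q_n X ^ k`, which has degree below `k` only when `q_n = 0`. -/
theorem eq_zero_of_degree_mulSeries_lt (k : ℕ) (P : PowerSeries (Polynomial R))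
    (hP : PowerSeries.coeff 0 P = Polynomial.X ^ k) (q : PowerSeries (Polynomial R))
    (h : ∀ n m, k ≤ m → (PowerSeries.coeff n (mulSeries q P)).coeff m = 0) : q = 0 := by
  ext n : 1
  induction n using Nat.strong_induction_on with
  | _ n ih =>
    ext m
    have := h n (m + k) (by omega)
    rw [coeff_mulSeries_eq, hP, Finset.sum_eq_zero, add_zero, Polynomial.coeff_mul_X_pow] at this
    · simpa using this
    · intro i hi
      rw [ih i (Finset.mem_range.mp hi)]
      simp

theorem Cyc.smul_mk (P : ATilde R) (f : PowerSeries R) (u : ATilde R) :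
    f • (Submodule.Quotient.mk u : Cyc R P) =
      Submodule.Quotient.mk (ATilde.ofSeries R f * u) := rfl

theorem Cyc.aAct_mk (P : ATilde R) (u : ATilde R) :
    Cyc.aAct P (Submodule.Quotient.mk u) = Submodule.Quotient.mk (ATilde.a R * u) := rfl

theorem ATilde.series_a_pow (i : ℕ) :
    (ATilde.a R ^ i).series = PowerSeries.C (Polynomial.X ^ i) := by
  induction i with
  | zero => simp; rfl
  | succ i ih =>
    rw [pow_succ', ATilde.series_a_mul, ih, pow_succ']
    simp [leftA]

theorem ATilde.series_sum {ι : Type*} (s : Finset ι) (u : ι → ATilde R) :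
    (∑ i ∈ s, u i).series = ∑ i ∈ s, (u i).series := by
  classical
  induction s using Finset.induction_on with
  | empty => rfl
  | insert i s hi ih => rw [Finset.sum_insert hi, Finset.sum_insert hi, ATilde.series_add, ih]

/-- The sums `∑ f_i(b) a ^ i` are the possible remainders: with the powers of `b` on the left they
are already in normal form, so no commutation is needed to read their coefficients. -/
theorem ATilde.coeff_series_sum_mul_a_pow {k : ℕ} (f : Fin k → PowerSeries R) (n m : ℕ) :
    (PowerSeries.coeff n (∑ i, ATilde.ofSeries R (f i) * ATilde.a R ^ (i : ℕ)).series).coeff m =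
      if h : m < k then PowerSeries.coeff n (f ⟨m, h⟩) else 0 := by
  rw [ATilde.series_sum, map_sum, Polynomial.finsetSum_coeff]
  have : ∀ i : Fin k, (PowerSeries.coeff n
      (ATilde.ofSeries R (f i) * ATilde.a R ^ (i : ℕ)).series).coeff m =
      if m = i then PowerSeries.coeff n (f i) else 0 := by
    intro i
    rw [ATilde.series_ofSeries_mul, ATilde.series_a_pow, PowerSeries.coeff_mul_C,
      PowerSeries.coeff_map, Polynomial.coeff_C_mul, Polynomial.coeff_X_pow]
    simp
  simp only [this]
  split_ifs with h
  · rw [Finset.sum_eq_single ⟨m, h⟩]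
    · simp
    · intro j _ hj
      rw [if_neg]
      rintro rfl
      exact hj rfl
    · simp
  · refine Finset.sum_eq_zero fun i _ => if_neg ?_
    have := i.2
    omega

/-- If `P` is congruent to `a ^ k` modulo `b`, then `1, a, …, a ^ (k - 1)` is a basis of
`Ã_R / Ã_R P`. -/
noncomputable def Cyc.powBasis (P : ATilde R) (k : ℕ)
    (hP : PowerSeries.coeff 0 P.series = Polynomial.X ^ k) :
    Module.Basis (Fin k) (PowerSeries R) (Cyc R P) :=
  Module.Basis.mk (v := fun i : Fin k => Submodule.Quotient.mk (ATilde.a R ^ (i : ℕ)))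
    (by
      rw [Fintype.linearIndependent_iff]
      intro f hf i
      have h1 : (Submodule.Quotient.mk (∑ i, ATilde.ofSeries R (f i) * ATilde.a R ^ (i : ℕ)) :
          Cyc R P) = 0 := by
        rw [← hf, ← Submodule.mkQ_apply, map_sum]
        rfl
      rw [Submodule.Quotient.mk_eq_zero, Ideal.mem_span_singleton'] at h1
      obtain ⟨q, hq⟩ := h1
      have hq' := congrArg ATilde.series hq
      rw [ATilde.series_mul] at hq'
      -- A relation among the powers of `a` is a multiple of `P` of degree below `k` in `a`, so
      -- uniqueness of division applies.
      have h0 : q.series = 0 := by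
        refine eq_zero_of_degree_mulSeries_lt k P.series hP _ fun n m hm => ?_
        rw [hq', ATilde.coeff_series_sum_mul_a_pow, dif_neg (by omega)]
      ext n
      have := ATilde.coeff_series_sum_mul_a_pow f n i
      rw [← hq', h0, dif_pos i.2] at this
      rw [← this]
      simp [mulSeries])
    (by
      rintro x -
      obtain ⟨u, rfl⟩ := Submodule.Quotient.mk_surjective _ x
      obtain ⟨q, hq⟩ := exists_degree_sub_mulSeries_lt k P.series hP u.series
      have h1 : u = ⟨q⟩ * P + ∑ i : Fin k, ATilde.ofSeries R
          (PowerSeries.mk fun n => (PowerSeries.coeff n (u.series - mulSeries q P.series)).coeff i)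
            * ATilde.a R ^ (i : ℕ) := by
        refine ATilde.ext ?_
        rw [ATilde.series_add, ATilde.series_mul, ← sub_eq_iff_eq_add']
        ext n m
        rw [ATilde.coeff_series_sum_mul_a_pow]
        split_ifs with h
        · simp
        · exact hq n m (by omega)
      have h2 : (Submodule.Quotient.mk u : Cyc R P) = ∑ i : Fin k,
          (PowerSeries.mk fun n => (PowerSeries.coeff n
            (u.series - mulSeries q P.series)).coeff i) •
            (Submodule.Quotient.mk (ATilde.a R ^ (i : ℕ)) : Cyc R P) := by
        conv_lhs => rw [h1]
        rw [Submodule.Quotient.mk_add, (Submodule.Quotient.mk_eq_zero _).mpr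
          (Ideal.mem_span_singleton'.mpr ⟨_, rfl⟩), zero_add, ← Submodule.mkQ_apply, map_sum]
        rfl
      rw [h2]
      exact Submodule.sum_mem _ fun i _ =>
        Submodule.smul_mem _ _ (Submodule.subset_span ⟨i, rfl⟩))

theorem Cyc.powBasis_apply (P : ATilde R) (k : ℕ)
    (hP : PowerSeries.coeff 0 P.series = Polynomial.X ^ k) (i : Fin k) :
    Cyc.powBasis P k hP i = Submodule.Quotient.mk (ATilde.a R ^ (i : ℕ)) :=
  Module.Basis.mk_apply _ _ i

/-! ### Base change and the commutation rule for the action of `a` -/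

variable {R' : Type*} [CommRing R'] (g : R →+* R') {P : ATilde R} {P' : ATilde R'}
  (h : ATilde.map g P = P')

theorem Cyc.map_mk (u : ATilde R) :
    Cyc.map g h (Submodule.Quotient.mk u) = Submodule.Quotient.mk (ATilde.map g u) := rfl

theorem Cyc.map_smul (f : PowerSeries R) (s : Cyc R P) :
    Cyc.map g h (f • s) = PowerSeries.map g f • Cyc.map g h s := by
  obtain ⟨u, rfl⟩ := Submodule.Quotient.mk_surjective _ s
  rw [Cyc.smul_mk, Cyc.map_mk, Cyc.map_mk, Cyc.smul_mk, map_mul, ATilde.map_ofSeries]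

theorem Cyc.map_aAct (s : Cyc R P) :
    Cyc.map g h (Cyc.aAct P s) = Cyc.aAct P' (Cyc.map g h s) := by
  obtain ⟨u, rfl⟩ := Submodule.Quotient.mk_surjective _ s
  rw [Cyc.aAct_mk, Cyc.map_mk, Cyc.map_mk, Cyc.aAct_mk, map_mul, ATilde.map_a]

/-- Change of coefficients sends `a ^ i` to `a ^ i`, hence basis to basis. Applied to restriction
and to evaluation of holomorphic functions, this reduces sheaf and fibre statements to coordinates.
-/
theorem Cyc.powBasis_repr_map {k : ℕ} (hP : PowerSeries.coeff 0 P.series = Polynomial.X ^ k)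
    (hP' : PowerSeries.coeff 0 P'.series = Polynomial.X ^ k) (s : Cyc R P) (i : Fin k) :
    (Cyc.powBasis P' k hP').repr (Cyc.map g h s) i =
      PowerSeries.map g ((Cyc.powBasis P k hP).repr s i) := by
  have hs := (Cyc.powBasis P k hP).sum_repr s
  have h1 : Cyc.map g h s = ∑ j, PowerSeries.map g ((Cyc.powBasis P k hP).repr s j) •
      Cyc.powBasis P' k hP' j := by
    conv_lhs => rw [← hs]
    rw [map_sum]
    refine Finset.sum_congr rfl fun j _ => ?_
    rw [Cyc.map_smul, Cyc.powBasis_apply, Cyc.powBasis_apply, Cyc.map_mk, map_pow, ATilde.map_a]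
  rw [h1, Module.Basis.repr_sum_self]

/-- Left multiplication by `a` contains the derivation `b² d/db`, so the Leibniz rule gives `a f(b)
= f(b) a + b² f'(b)`. -/
theorem ATilde.a_mul_ofSeries_mul (f : PowerSeries R) (u : ATilde R) :
    ATilde.a R * (ATilde.ofSeries R f * u) = ATilde.ofSeries R f * (ATilde.a R * u) +
      ATilde.ofSeries R (PowerSeries.X ^ 2 * PowerSeries.derivative R f) * u := by
  have hd : PowerSeries.derivative (Polynomial R) (PowerSeries.map Polynomial.C f) =
      PowerSeries.map Polynomial.C (PowerSeries.derivative R f) := by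
    ext n : 1
    simp [PowerSeries.coeff_derivative]
  refine ATilde.ext ?_
  rw [ATilde.series_add, ATilde.series_ofSeries_mul, ATilde.series_ofSeries_mul,
    ATilde.series_a_mul, ATilde.series_a_mul, ATilde.series_ofSeries_mul]
  simp only [leftA, LinearMap.coe_mk, AddHom.coe_mk, Derivation.leibniz, smul_eq_mul, map_mul,
    map_pow, PowerSeries.map_X, hd]
  ring

theorem Cyc.aAct_smul (f : PowerSeries R) (s : Cyc R P) :
    Cyc.aAct P (f • s) = f • Cyc.aAct P s +
      (PowerSeries.X ^ 2 * PowerSeries.derivative R f) • s := by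
  obtain ⟨u, rfl⟩ := Submodule.Quotient.mk_surjective _ s
  simp only [Cyc.smul_mk, Cyc.aAct_mk]
  rw [ATilde.a_mul_ofSeries_mul]
  rfl

theorem Cyc.iterate_aAct_one (i : ℕ) :
    (Cyc.aAct P)^[i] (Submodule.Quotient.mk 1) = Submodule.Quotient.mk (ATilde.a R ^ i) := by
  induction i with
  | zero => simp
  | succ i ih => rw [Function.iterate_succ_apply', ih, Cyc.aAct_mk, pow_succ']

theorem ATilde.C_mul_b (r : R) (u : ATilde R) :
    ATilde.ofSeries R (PowerSeries.C r) * ATilde.b R * u =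
      ATilde.ofSeries R (PowerSeries.C r * PowerSeries.X) * u := by
  rw [map_mul, ATilde.ofSeries_X]

end Division

/-! ### The right factors of the operator and the relations between their classes -/

section Theta

variable {R : Type*} [CommRing R] [Algebra ℂ R] (lam : ℕ → ℚ) (S : ℕ → PowerSeries R)

/-- Modulo `b` multiplication is commutative, each of the `n + 1` linear factors becomes `a` and
each inverse series becomes `1`. `PowerSeries.invOfUnit _ 1` has constant term `1` by construction,
whatever the `S_j` are. -/
theorem coeff_zero_series_thetaP (n : ℕ) :
    PowerSeries.coeff 0 (thetaP lam S n).series = Polynomial.X ^ (n + 1) := by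
  have hmul : ∀ u v : ATilde R, PowerSeries.coeff 0 (u * v).series =
      PowerSeries.coeff 0 u.series * PowerSeries.coeff 0 v.series :=
    fun u v => coeff_zero_mulSeries _ _
  have hlin : ∀ r : R, PowerSeries.coeff 0 (ATilde.a R - ATilde.ofSeries R (PowerSeries.C r) *
      ATilde.b R).series = Polynomial.X := by
    intro r
    have : (ATilde.a R - ATilde.ofSeries R (PowerSeries.C r) * ATilde.b R).series =
        (ATilde.a R).series - (ATilde.ofSeries R (PowerSeries.C r) * ATilde.b R).series := by
      rw [eq_sub_iff_add_eq, ← ATilde.series_add, sub_add_cancel]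
    rw [this, map_sub, hmul]
    simp [ATilde.a, ATilde.b]
  induction n with
  | zero => rw [thetaP, hlin, zero_add, pow_one]
  | succ n ih =>
    rw [thetaP, hmul, hmul, ih, hlin]
    have : PowerSeries.coeff 0 (ATilde.ofSeries R (PowerSeries.invOfUnit (S (n + 1)) 1)).series =
        1 := by
      simp [ATilde.ofSeries]
    rw [this, mul_one, ← pow_succ]

/-- The right factors of `thetaP lam S n`: `thetaTail lam S i n` is
`S_{i+1}⁻¹ (a - λ_{i+2} b) ⋯ Sₙ⁻¹ (a - λ_{n+1} b)`, so that `thetaP lam S n` is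
`thetaP lam S i * thetaTail lam S i n` for `i ≤ n`. -/
noncomputable def thetaTail (i : ℕ) : ℕ → ATilde R
  | 0 => 1
  | n + 1 => if n + 1 ≤ i then 1 else
      thetaTail i n * (ATilde.ofSeries R (PowerSeries.invOfUnit (S (n + 1)) 1) *
      (ATilde.a R -
        ATilde.ofSeries R (PowerSeries.C (algebraMap ℂ R (lam (n + 2) : ℂ))) * ATilde.b R))

theorem thetaTail_self (n : ℕ) : thetaTail lam S n n = 1 := by
  cases n <;> simp [thetaTail]

theorem thetaP_eq_mul_thetaTail {i n : ℕ} (h : i ≤ n) :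
    thetaP lam S n = thetaP lam S i * thetaTail lam S i n := by
  induction n with
  | zero =>
    obtain rfl : i = 0 := by omega
    rw [thetaTail_self, mul_one]
  | succ n ih =>
    rcases h.eq_or_lt with rfl | h
    · rw [thetaTail_self, mul_one]
    · rw [thetaTail, if_neg (by omega), thetaP, ih (by omega)]
      simp only [mul_assoc]

theorem thetaTail_eq_mul_thetaTail {i n : ℕ} (h : i < n) :
    thetaTail lam S i n = ATilde.ofSeries R (PowerSeries.invOfUnit (S (i + 1)) 1) *
      ((ATilde.a R -
        ATilde.ofSeries R (PowerSeries.C (algebraMap ℂ R (lam (i + 2) : ℂ))) * ATilde.b R) *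
      thetaTail lam S (i + 1) n) := by
  induction n with
  | zero => omega
  | succ n ih =>
    rw [thetaTail, if_neg (by omega)]
    rcases (Nat.lt_succ_iff.mp h).eq_or_lt with rfl | h
    · rw [thetaTail_self, thetaTail_self, one_mul, mul_one]
    · rw [ih h, thetaTail, if_neg (by omega)]
      simp only [mul_assoc]

/-- The classes of the right factors of `thetaP lam S n`. -/
noncomputable def tailClass (n i : ℕ) : Cyc R (thetaP lam S n) :=
  Submodule.Quotient.mk (thetaTail lam S i n)

/-- Multiplying the longest tail on the left by `a - λ_1 b` restores the whole operator, whose class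
is zero. -/
theorem aAct_tailClass_zero (n : ℕ) :
    Cyc.aAct (thetaP lam S n) (tailClass lam S n 0) =
      (PowerSeries.C (algebraMap ℂ R (lam 1 : ℂ)) * PowerSeries.X) • tailClass lam S n 0 := by
  rw [← sub_eq_zero, tailClass, Cyc.aAct_mk, Cyc.smul_mk, ← ATilde.C_mul_b,
    ← Submodule.Quotient.mk_sub, ← sub_mul, Submodule.Quotient.mk_eq_zero]
  rw [show (ATilde.a R - ATilde.ofSeries R (PowerSeries.C (algebraMap ℂ R (lam 1 : ℂ))) *
    ATilde.b R) = thetaP lam S 0 from rfl, ← thetaP_eq_mul_thetaTail lam S (Nat.zero_le n)]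
  exact Ideal.subset_span rfl

/-- The tail `i` is `S_{i+1}⁻¹ (a - λ_{i+2} b)` times the tail `i + 1`; multiplying by `S_{i+1}` on
the left removes the inverse and gives the relation. -/
theorem aAct_tailClass_succ (hS : ∀ j, PowerSeries.constantCoeff (S j) = 1) {n i : ℕ}
    (h : i < n) :
    Cyc.aAct (thetaP lam S n) (tailClass lam S n (i + 1)) =
      (PowerSeries.C (algebraMap ℂ R (lam (i + 2) : ℂ)) * PowerSeries.X) •
        tailClass lam S n (i + 1) + S (i + 1) • tailClass lam S n i := by
  rw [← sub_eq_iff_eq_add']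
  simp only [tailClass]
  rw [Cyc.aAct_mk, Cyc.smul_mk, Cyc.smul_mk, ← ATilde.C_mul_b,
    ← Submodule.Quotient.mk_sub, ← sub_mul, thetaTail_eq_mul_thetaTail lam S h, ← mul_assoc
      (ATilde.ofSeries R (S (i + 1))), ← map_mul, PowerSeries.mul_invOfUnit _ 1 (by simp [hS]),
    map_one, one_mul]

theorem tailClass_self (n : ℕ) : tailClass lam S n n = Submodule.Quotient.mk 1 := by
  rw [tailClass, thetaTail_self]

end Theta

/-! ### Chains -/

/-- Although `a` is not `R[[b]]`-linear, the error in the Leibniz rule is a multiple of the vector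
itself. Its effect on a span can thus be tested on generators, provided the target span contains
them. -/
theorem map_mem_span_of_leibniz {R : Type*} [CommRing R] {M : Type*} [AddCommGroup M]
    [Module (PowerSeries R) M] {aM : M → M} (hadd : ∀ v w, aM (v + w) = aM v + aM w)
    (hl : ∀ (f : PowerSeries R) (v : M), aM (f • v) = f • aM v +
      (PowerSeries.X ^ 2 * PowerSeries.derivative R f) • v)
    {s t : Set M} (hst : s ⊆ t) (h : ∀ v ∈ s, aM v ∈ Submodule.span (PowerSeries R) t) {v : M}
    (hv : v ∈ Submodule.span (PowerSeries R) s) : aM v ∈ Submodule.span (PowerSeries R) t := by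
  induction hv using Submodule.span_induction with
  | mem x hx => exact h x hx
  | zero =>
    have : aM 0 = 0 := by simpa using hl 0 0
    rw [this]
    exact Submodule.zero_mem _
  | add x y _ _ hx hy => rw [hadd]; exact Submodule.add_mem _ hx hy
  | smul f x hx0 hx =>
    rw [hl]
    exact Submodule.add_mem _ (Submodule.smul_mem _ _ hx)
      (Submodule.smul_mem _ _ (Submodule.span_mono hst hx0))

section Chain

variable {R : Type*} [CommRing R] [Algebra ℂ R] {M : Type*} [AddCommGroup M]
  [Module (PowerSeries R) M]

/-- A sequence `e_0, …, e_n` in an `(a,b)`-module with `a e_0 = λ₁ b e_0` and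
`a e_{i+1} = λ_{i+2} b e_{i+1} + S_{i+1} e_i`. -/
structure IsChain (aM : M → M) (lam : ℕ → ℚ) (S : ℕ → PowerSeries R) (n : ℕ) (e : ℕ → M) :
    Prop where
  add : ∀ v w, aM (v + w) = aM v + aM w
  leibniz : ∀ (f : PowerSeries R) (v : M), aM (f • v) = f • aM v +
    (PowerSeries.X ^ 2 * PowerSeries.derivative R f) • v
  zero : aM (e 0) = (PowerSeries.C (algebraMap ℂ R (lam 1 : ℂ)) * PowerSeries.X) • e 0
  succ : ∀ i < n, aM (e (i + 1)) =
    (PowerSeries.C (algebraMap ℂ R (lam (i + 2) : ℂ)) * PowerSeries.X) • e (i + 1) +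
      S (i + 1) • e i

variable {aM : M → M} {lam : ℕ → ℚ} {S : ℕ → PowerSeries R} {n : ℕ} {e : ℕ → M}

namespace IsChain

theorem iterate_mem_span (hc : IsChain aM lam S n e) (ν : ℕ) :
    aM^[ν] (e n) ∈
      Submodule.span (PowerSeries R) (Set.range fun i : Fin (n + 1) => e i) := by
  have hmem : ∀ i ≤ n, e i ∈
      Submodule.span (PowerSeries R) (Set.range fun i : Fin (n + 1) => e i) :=
    fun i hi => Submodule.subset_span ⟨⟨i, by omega⟩, rfl⟩
  induction ν with
  | zero => exact hmem n le_rfl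
  | succ ν ih =>
    rw [Function.iterate_succ_apply']
    refine map_mem_span_of_leibniz hc.add hc.leibniz subset_rfl ?_ ih
    rintro _ ⟨⟨i, hi⟩, rfl⟩
    cases i with
    | zero => rw [hc.zero]; exact Submodule.smul_mem _ _ (hmem 0 (by omega))
    | succ i =>
      rw [hc.succ i (by omega)]
      exact Submodule.add_mem _ (Submodule.smul_mem _ _ (hmem _ (by omega)))
        (Submodule.smul_mem _ _ (hmem _ (by omega)))

/-- The relation for `a e_{j+1}` expresses `S_{j+1} e_j` through `e_{j+1}` and `a e_{j+1}`, and
`S_{j+1}` is a unit. Descending from `e_n`, each step costs one more application of `a`. -/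
theorem mem_span_iterate (hc : IsChain aM lam S n e)
    (hS : ∀ j, PowerSeries.constantCoeff (S j) = 1) (i : ℕ) (hi : i ≤ n) :
    e (n - i) ∈ Submodule.span (PowerSeries R) ((fun ν : ℕ => aM^[ν] (e n)) '' Set.Iic i) := by
  induction i with
  | zero => exact Submodule.subset_span ⟨0, by simp, rfl⟩
  | succ i ih =>
    have hi' := ih (by omega)
    obtain ⟨j, hj⟩ : ∃ j, n - i = j + 1 := ⟨n - i - 1, by omega⟩
    obtain hj' : n - (i + 1) = j := by omega
    rw [hj] at hi'
    rw [hj']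
    have hsub : (fun ν : ℕ => aM^[ν] (e n)) '' Set.Iic i ⊆
        (fun ν : ℕ => aM^[ν] (e n)) '' Set.Iic (i + 1) :=
      Set.image_mono (Set.Iic_subset_Iic.mpr (by omega))
    have h1 : aM (e (j + 1)) ∈ Submodule.span (PowerSeries R)
        ((fun ν : ℕ => aM^[ν] (e n)) '' Set.Iic (i + 1)) := by
      refine map_mem_span_of_leibniz hc.add hc.leibniz hsub ?_ hi'
      rintro _ ⟨ν, hν, rfl⟩
      refine Submodule.subset_span ⟨ν + 1, ?_, Function.iterate_succ_apply' _ _ _⟩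
      simp only [Set.mem_Iic] at hν ⊢
      omega
    have h2 : S (j + 1) • e j ∈ Submodule.span (PowerSeries R)
        ((fun ν : ℕ => aM^[ν] (e n)) '' Set.Iic (i + 1)) := by
      have h3 := hc.succ j (by omega)
      rw [← sub_eq_iff_eq_add'] at h3
      rw [← h3]
      exact Submodule.sub_mem _ h1 (Submodule.smul_mem _ _ (Submodule.span_mono hsub hi'))
    have h4 := Submodule.smul_mem _ (PowerSeries.invOfUnit (S (j + 1)) 1) h2
    rwa [smul_smul, mul_comm, PowerSeries.mul_invOfUnit _ 1 (by simp [hS]), one_smul] at h4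

theorem span_iterate_fin (hc : IsChain aM lam S n e)
    (hS : ∀ j, PowerSeries.constantCoeff (S j) = 1) :
    Submodule.span (PowerSeries R) (Set.range fun i : Fin (n + 1) => aM^[(i : ℕ)] (e n)) =
      Submodule.span (PowerSeries R) (Set.range fun i : Fin (n + 1) => e i) := by
  apply le_antisymm
  · rw [Submodule.span_le]
    rintro _ ⟨i, rfl⟩
    exact hc.iterate_mem_span i
  · rw [Submodule.span_le]
    rintro _ ⟨i, rfl⟩
    have := hc.mem_span_iterate hS (n - i) (by omega)
    rw [show n - (n - (i : ℕ)) = i by have := i.2; omega] at this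
    refine Submodule.span_mono ?_ this
    rintro _ ⟨ν, hν, rfl⟩
    simp only [Set.mem_Iic] at hν
    exact ⟨⟨ν, by omega⟩, rfl⟩

theorem span_iterate (hc : IsChain aM lam S n e)
    (hS : ∀ j, PowerSeries.constantCoeff (S j) = 1) :
    Submodule.span (PowerSeries R) (Set.range fun ν : ℕ => aM^[ν] (e n)) =
      Submodule.span (PowerSeries R) (Set.range fun i : Fin (n + 1) => e i) := by
  apply le_antisymm
  · rw [Submodule.span_le]
    rintro _ ⟨i, rfl⟩
    exact hc.iterate_mem_span i
  · rw [← hc.span_iterate_fin hS]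
    refine Submodule.span_mono ?_
    rintro _ ⟨i, rfl⟩
    exact ⟨i, rfl⟩

end IsChain

/-- A family of `n` elements that spans the same submodule as `n` independent elements is
independent. -/
theorem linearIndependent_of_span_eq {A N : Type*} [CommRing A] [AddCommGroup N] [Module A N]
    {m : ℕ} {v w : Fin m → N} (hv : LinearIndependent A v)
    (h : Submodule.span A (Set.range w) = Submodule.span A (Set.range v)) :
    LinearIndependent A w := by
  let B := Module.Basis.span hv
  have hw : ∀ i, w i ∈ Submodule.span A (Set.range v) := fun i => h ▸ Submodule.subset_span ⟨i, rfl⟩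
  let f : (Fin m → A) →ₗ[A] Submodule.span A (Set.range v) :=
    Fintype.linearCombination A (fun i => (⟨w i, hw i⟩ : Submodule.span A (Set.range v)))
  have hf : Function.Surjective f := by
    rintro ⟨x, hx⟩
    rw [← h, Submodule.mem_span_range_iff_exists_fun] at hx
    obtain ⟨c, hc⟩ := hx
    refine ⟨c, Subtype.ext ?_⟩
    simpa [f, Fintype.linearCombination_apply] using hc
  -- In the basis `B` the map that sends the standard basis to `w` is a surjective endomorphism of
  -- `A ^ m`; over a commutative ring it is injective.
  have hf' : Function.Injective (B.equivFun.toLinearMap ∘ₗ f) :=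
    OrzechProperty.injective_of_surjective_endomorphism _ (B.equivFun.surjective.comp hf)
  have hinj : Function.Injective f := fun x y hxy => hf' (by simp [hxy])
  have hli : LinearIndependent A
      (fun i => (⟨w i, hw i⟩ : Submodule.span A (Set.range v))) := by
    rw [Fintype.linearIndependent_iff]
    intro c hc i
    exact congrFun (hinj (a₁ := c) (a₂ := 0) (by
      rw [map_zero]; simpa [f, Fintype.linearCombination_apply] using hc)) i
  exact hli.map' (Submodule.subtype _) (Submodule.ker_subtype _)

variable (lam S n) in
theorem isChain_tailClass (hS : ∀ j, PowerSeries.constantCoeff (S j) = 1) :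
    IsChain (Cyc.aAct (thetaP lam S n)) lam S n (tailClass lam S n) where
  add := map_add _
  leibniz := Cyc.aAct_smul
  zero := aAct_tailClass_zero lam S n
  succ _ hi := aAct_tailClass_succ lam S hS hi

/-- The last tail is `1`, so the iterates of `a` on it are the power basis, and a chain spans the
same module as the iterates of its last element. -/
theorem span_tailClass (hS : ∀ j, PowerSeries.constantCoeff (S j) = 1) :
    Submodule.span (PowerSeries R) (Set.range fun i : Fin (n + 1) => tailClass lam S n i) = ⊤ := by
  rw [← (isChain_tailClass lam S n hS).span_iterate_fin hS, tailClass_self,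
    ← (Cyc.powBasis _ _ (coeff_zero_series_thetaP lam S n)).span_eq]
  congr 2
  funext i
  rw [Cyc.iterate_aAct_one, Cyc.powBasis_apply]

variable (lam S n) in
/-- The classes of the right factors of `thetaP lam S n` form a basis of
`Ã_R / Ã_R (thetaP lam S n)`. -/
noncomputable def tailBasis (hS : ∀ j, PowerSeries.constantCoeff (S j) = 1) :
    Module.Basis (Fin (n + 1)) (PowerSeries R) (Cyc R (thetaP lam S n)) :=
  Module.Basis.mk (v := fun i : Fin (n + 1) => tailClass lam S n i)
    (linearIndependent_of_span_eq
      (Cyc.powBasis _ _ (coeff_zero_series_thetaP lam S n)).linearIndependent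
      (by rw [span_tailClass hS, Module.Basis.span_eq]))
    (span_tailClass hS).ge

theorem tailBasis_apply (hS : ∀ j, PowerSeries.constantCoeff (S j) = 1) (i : Fin (n + 1)) :
    tailBasis lam S n hS i = tailClass lam S n i :=
  Module.Basis.mk_apply _ _ i

/-- The morphism from `Ã_R / Ã_R (thetaP lam S n)` defined by a chain. -/
noncomputable def chainMap (lam : ℕ → ℚ) (S : ℕ → PowerSeries R) (n : ℕ)
    (hS : ∀ j, PowerSeries.constantCoeff (S j) = 1) (e : ℕ → M) :
    Cyc R (thetaP lam S n) →ₗ[PowerSeries R] M :=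
  (tailBasis lam S n hS).constr ℕ fun i => e i

theorem chainMap_tailClass (hS : ∀ j, PowerSeries.constantCoeff (S j) = 1) {i : ℕ} (hi : i ≤ n) :
    chainMap lam S n hS e (tailClass lam S n i) = e i := by
  have := (tailBasis lam S n hS).constr_basis ℕ (fun i => e i) ⟨i, by omega⟩
  rwa [tailBasis_apply] at this

/-- On the tail classes both sides are given by the same chain relations; the Leibniz rule, shared
by source and target, extends this to all combinations. -/
theorem chainMap_aAct (hS : ∀ j, PowerSeries.constantCoeff (S j) = 1) (hc : IsChain aM lam S n e)
    (s : Cyc R (thetaP lam S n)) :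
    chainMap lam S n hS e (Cyc.aAct _ s) = aM (chainMap lam S n hS e s) := by
  have hs : s ∈ Submodule.span (PowerSeries R)
      (Set.range fun i : Fin (n + 1) => tailClass lam S n i) := by
    rw [span_tailClass hS]; trivial
  induction hs using Submodule.span_induction with
  | mem x hx =>
    obtain ⟨⟨i, hi⟩, rfl⟩ := hx
    cases i with
    | zero =>
      simp only [aAct_tailClass_zero, map_smul]
      rw [chainMap_tailClass hS (by omega), hc.zero]
    | succ i =>
      simp only [aAct_tailClass_succ lam S hS (show i < n by omega), map_add, map_smul]
      rw [chainMap_tailClass hS (by omega), chainMap_tailClass hS (by omega),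
        hc.succ i (by omega)]
  | zero =>
    have : aM 0 = 0 := by simpa using hc.leibniz 0 0
    simp [this]
  | add x y _ _ hx hy => rw [map_add, map_add, hx, hy, map_add, hc.add]
  | smul f x _ hx => rw [Cyc.aAct_smul, map_add, map_smul, map_smul, hx, map_smul, hc.leibniz]

theorem chainMap_injective (hS : ∀ j, PowerSeries.constantCoeff (S j) = 1)
    (he : LinearIndependent (PowerSeries R) fun i : Fin (n + 1) => e i) :
    Function.Injective (chainMap lam S n hS e) := by
  rw [injective_iff_map_eq_zero]
  intro s hs
  rw [chainMap, Module.Basis.constr_apply_fintype] at hs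
  refine (tailBasis lam S n hS).equivFun.map_eq_zero_iff.mp (funext fun i => ?_)
  exact Fintype.linearIndependent_iff.mp he _ hs i

theorem range_chainMap (hS : ∀ j, PowerSeries.constantCoeff (S j) = 1) :
    LinearMap.range (chainMap lam S n hS e) =
      Submodule.span (PowerSeries R) (Set.range fun i : Fin (n + 1) => e i) :=
  (tailBasis lam S n hS).constr_range ℕ

end Chain

/-! ### Chains in `Ξ_λ^{(N)}` -/

section XiChain

theorem coeff_succ_X_sq_mul_derivative {R : Type*} [CommRing R] (f : PowerSeries R) (n : ℕ) :
    PowerSeries.coeff (n + 1) (PowerSeries.X ^ 2 * PowerSeries.derivative R f) =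
      n * PowerSeries.coeff n f := by
  rw [pow_two, mul_assoc, PowerSeries.coeff_succ_X_mul]
  cases n with
  | zero => simp
  | succ m => rw [PowerSeries.coeff_succ_X_mul, PowerSeries.coeff_derivative]; push_cast; ring

theorem Xi.map_smul {R R' : Type*} [CommRing R] [CommRing R'] {Λ : Finset ℚ} {N : ℕ} (g : R →+* R')
    (f : PowerSeries R) (v : Xi R Λ N) :
    Xi.map g (f • v) = PowerSeries.map g f • Xi.map g v := by
  funext i; simp [Xi.map]

theorem Xi.map_add {R R' : Type*} [CommRing R] [CommRing R'] {Λ : Finset ℚ} {N : ℕ} (g : R →+* R')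
    (v w : Xi R Λ N) : Xi.map g (v + w) = Xi.map g v + Xi.map g w := by
  funext i; simp [Xi.map]

variable {R : Type*} [CommRing R] [Algebra ℂ R]

theorem Xi.aMap_add {Λ : Finset ℚ} {N : ℕ} (v w : Xi R Λ N) :
    Xi.aMap (v + w) = Xi.aMap v + Xi.aMap w := by
  funext i
  simp only [Xi.aMap, Pi.add_apply, _root_.map_add]
  split_ifs <;> ring

theorem Xi.aMap_smul {Λ : Finset ℚ} {N : ℕ} (f : PowerSeries R) (v : Xi R Λ N) :
    Xi.aMap (f • v) = f • Xi.aMap v +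
      (PowerSeries.X ^ 2 * PowerSeries.derivative R f) • v := by
  funext i
  simp only [Xi.aMap, Pi.add_apply, Pi.smul_apply, smul_eq_mul, Derivation.leibniz]
  split_ifs <;> ring

/-- A nonzero constant plus a nilpotent shift is invertible: solve from the top logarithm downwards.
Only `c` is inverted, which keeps the lemma valid over any `ℂ`-algebra, and the support does not
grow. -/
theorem exists_mul_add_shift_eq {c : ℂ} (hc : c ≠ 0) (i : ℕ) (y : ℕ → R)
    (hy : ∀ j, i ≤ j → y j = 0) :
    ∃ x : ℕ → R, (∀ j, algebraMap ℂ R c * x j + x (j + 1) = y j) ∧ ∀ j, i ≤ j → x j = 0 := by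
  induction i generalizing y with
  | zero => exact ⟨0, fun j => by simp [hy j], fun _ _ => rfl⟩
  | succ i ih =>
    set z := algebraMap ℂ R c⁻¹ * y i with hz
    have hcz : algebraMap ℂ R c * z = y i := by
      rw [hz, ← mul_assoc, ← map_mul, mul_inv_cancel₀ hc, map_one, one_mul]
    obtain ⟨x, hx, hx0⟩ := ih
      -- The top unknown `z` is now known; removing it shortens the system and changes the
      -- right-hand side only one place below.
      (fun j => if j = i then 0 else if j + 1 = i then y j - z else y j) (by
        intro j hj
        by_cases h : j = i
        · simp [h]
        · simp [h, show j + 1 ≠ i by omega, hy j (by omega)])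
    refine ⟨fun j => if j = i then z else x j, fun j => ?_, fun j hj => ?_⟩
    · have := hx j
      by_cases h : j = i
      · subst h
        simp [hcz, hx0 (j + 1) (by omega)]
      · by_cases h' : j + 1 = i
        · simp only [h, h', if_true, if_false] at this ⊢
          rw [hx0 i le_rfl, add_zero] at this
          rw [this]; ring
        · simpa only [h, h', if_false] using this
    · simp [show j ≠ i by omega, hx0 j (by omega)]

/-- Solution of `(a - (λ + d) b) ψ = η` in terms of the coordinates on the basis `e_{λ,j}`; the
solution has one more logarithm than `η`. -/
theorem exists_chain_step (d e i : ℕ) (η : ℕ → PowerSeries R) (h0 : ∀ j, i < j → η j = 0)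
    (hdvd : ∀ j, PowerSeries.X ^ (e + 1) ∣ η j) :
    ∃ ψ : ℕ → PowerSeries R,
      (∀ j, PowerSeries.X ^ 2 * PowerSeries.derivative R (ψ j) + PowerSeries.X * ψ (j + 1) =
        PowerSeries.C (algebraMap ℂ R d) * PowerSeries.X * ψ j + η j) ∧
      (∀ j, i + 1 < j → ψ j = 0) ∧
      ψ (i + 1) = PowerSeries.C (PowerSeries.coeff (d + 1) (η i)) * PowerSeries.X ^ d ∧
      ∀ j, PowerSeries.X ^ e ∣ ψ j := by
  simp only [PowerSeries.X_pow_dvd_iff] at hdvd ⊢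
  -- Here `x j` is the coefficient of `b ^ n` in `ψ j`. The equation loses one factor `b`, so the
  -- coefficient of `b ^ n` in `ψ` is matched with that of `b ^ (n + 1)` in `η`.
  have key : ∀ n : ℕ, ∃ x : ℕ → R,
      (∀ j, algebraMap ℂ R ((n : ℂ) - d) * x j + x (j + 1) = PowerSeries.coeff (n + 1) (η j)) ∧
      (∀ j, i + 1 < j → x j = 0) ∧
      (x (i + 1) = if n = d then PowerSeries.coeff (d + 1) (η i) else 0) ∧
      (n < e → ∀ j, x j = 0) := by
    intro n
    by_cases hn : n < e
    · refine ⟨0, fun j => ?_, fun _ _ => rfl, ?_, fun _ _ => rfl⟩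
      · simp [hdvd j (n + 1) (by omega)]
      · split_ifs with h
        · rw [← h, hdvd i (n + 1) (by omega)]; rfl
        · rfl
    by_cases h : n = d
    · subst h
      -- Resonance `n = d`: the scalar term vanishes and the system reads `x (j + 1) = η_j`. Its
      -- solution is a shift, with the free value `x 0` set to `0`; this is where the new logarithm
      -- enters.
      refine ⟨fun j => Nat.casesOn j 0 fun j => PowerSeries.coeff (n + 1) (η j), fun j => ?_,
        fun j hj => ?_, by simp, fun h => absurd h hn⟩
      · simp
      · obtain ⟨j, rfl⟩ : ∃ t, j = t + 1 := ⟨j - 1, by omega⟩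
        simp [h0 j (by omega)]
    · obtain ⟨x, hx, hx0⟩ := exists_mul_add_shift_eq (R := R)
        (sub_ne_zero.mpr (Nat.cast_injective.ne h) : (n : ℂ) - d ≠ 0) (i + 1)
        (fun j => PowerSeries.coeff (n + 1) (η j)) (fun j hj => by simp [h0 j (by omega)])
      exact ⟨x, hx, fun j hj => hx0 j (by omega), by simp [h, hx0], fun h => absurd h hn⟩
  choose x hx1 hx2 hx3 hx4 using key
  refine ⟨fun j => PowerSeries.mk fun n => x n j, fun j => ?_, fun j hj => ?_, ?_, fun j n hn => ?_⟩
  · ext n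
    cases n with
    | zero =>
      have := hdvd j 0 (by omega)
      rw [PowerSeries.coeff_zero_eq_constantCoeff_apply] at this
      simp [this, pow_two, mul_assoc]
    | succ n =>
      rw [map_add, map_add, coeff_succ_X_sq_mul_derivative, PowerSeries.coeff_succ_X_mul, mul_assoc,
        PowerSeries.coeff_C_mul, PowerSeries.coeff_succ_X_mul, ← hx1 n j]
      simp only [PowerSeries.coeff_mk, map_sub, map_natCast]
      ring
  · ext n; simp [hx2 n j hj]
  · ext n; simp [hx3, PowerSeries.coeff_X_pow]
  · simp [hx4 n hn]

/-- Existence of a chain, in terms of the coordinates on the basis `e_{λ,j}`. -/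
theorem exists_chain_coords (n : ℕ) (p d : ℕ → ℕ) (S : ℕ → PowerSeries R)
    (hd : ∀ i < n, d (i + 1) + 1 = d i + p (i + 1)) (hd0 : n ≤ d 0) :
    ∃ ψ : ℕ → ℕ → PowerSeries R,
      (∀ j, PowerSeries.X ^ 2 * PowerSeries.derivative R (ψ 0 j) + PowerSeries.X * ψ 0 (j + 1) =
        PowerSeries.C (algebraMap ℂ R (d 0)) * PowerSeries.X * ψ 0 j) ∧
      (∀ i < n, ∀ j, PowerSeries.X ^ 2 * PowerSeries.derivative R (ψ (i + 1) j) +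
        PowerSeries.X * ψ (i + 1) (j + 1) =
        PowerSeries.C (algebraMap ℂ R (d (i + 1))) * PowerSeries.X * ψ (i + 1) j +
          S (i + 1) * ψ i j) ∧
      (∀ i ≤ n, ∀ j, i < j → ψ i j = 0) ∧
      (∀ i ≤ n, ψ i i = PowerSeries.C
        (∏ t ∈ Finset.range i, PowerSeries.coeff (p (t + 1)) (S (t + 1))) *
          PowerSeries.X ^ d i) := by
  -- The hypotheses stand after the existential so that `choose` yields a total function that can be
  -- iterated. The invariant `b ^ (n - i) ∣ ψ_i` lets each step spend one factor `b`; the condition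
  -- `n ≤ d 0` supplies enough of them.
  have step : ∀ i (v : ℕ → PowerSeries R), ∃ w : ℕ → PowerSeries R, i < n →
      (∀ j, i < j → v j = 0) → (∀ j, PowerSeries.X ^ (n - i) ∣ v j) →
      (∀ j, PowerSeries.X ^ 2 * PowerSeries.derivative R (w j) + PowerSeries.X * w (j + 1) =
        PowerSeries.C (algebraMap ℂ R (d (i + 1))) * PowerSeries.X * w j + S (i + 1) * v j) ∧
      (∀ j, i + 1 < j → w j = 0) ∧
      w (i + 1) = PowerSeries.C (PowerSeries.coeff (d (i + 1) + 1) (S (i + 1) * v i)) *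
        PowerSeries.X ^ d (i + 1) ∧
      ∀ j, PowerSeries.X ^ (n - (i + 1)) ∣ w j := by
    intro i v
    by_cases h : i < n ∧ (∀ j, i < j → v j = 0) ∧ ∀ j, PowerSeries.X ^ (n - i) ∣ v j
    · obtain ⟨h1, h2, h3⟩ := h
      obtain ⟨w, hw⟩ := exists_chain_step (d (i + 1)) (n - (i + 1)) i (fun j => S (i + 1) * v j)
        (fun j hj => by simp [h2 j hj]) (fun j => by
          rw [show n - (i + 1) + 1 = n - i by omega]
          exact (h3 j).mul_left _)
      exact ⟨w, fun _ _ _ => hw⟩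
    · exact ⟨0, fun h1 h2 h3 => absurd ⟨h1, h2, h3⟩ h⟩
  choose w hw using step
  let ψ : ℕ → ℕ → PowerSeries R := fun i =>
    Nat.rec (fun j => if j = 0 then PowerSeries.X ^ d 0 else 0) w i
  have hgood : ∀ i ≤ n, (∀ j, i < j → ψ i j = 0) ∧ ∀ j, PowerSeries.X ^ (n - i) ∣ ψ i j := by
    intro i
    induction i with
    | zero =>
      refine fun _ => ⟨fun j hj => if_neg hj.ne', fun j => ?_⟩
      change _ ∣ (if j = 0 then _ else _)
      split_ifs
      · exact pow_dvd_pow _ (by omega)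
      · exact dvd_zero _
    | succ i ih =>
      intro hi
      obtain ⟨h1, h2⟩ := ih (by omega)
      obtain ⟨-, h3, -, h4⟩ := hw i (ψ i) (by omega) h1 h2
      exact ⟨h3, h4⟩
  refine ⟨ψ, fun j => ?_, fun i hi => ?_, fun i hi => (hgood i hi).1, fun i => ?_⟩
  · change PowerSeries.X ^ 2 * PowerSeries.derivative R (if j = 0 then PowerSeries.X ^ d 0 else 0) +
      PowerSeries.X * (if j + 1 = 0 then PowerSeries.X ^ d 0 else 0) = _ *
        (if j = 0 then PowerSeries.X ^ d 0 else 0)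
    rw [if_neg (Nat.succ_ne_zero j)]
    split_ifs with h
    · ext m
      cases m with
      | zero => simp [pow_two, mul_assoc]
      | succ m =>
        rw [mul_zero, add_zero, coeff_succ_X_sq_mul_derivative, mul_assoc,
          PowerSeries.coeff_C_mul, PowerSeries.coeff_succ_X_mul, PowerSeries.coeff_X_pow]
        split_ifs with h
        · simp [h]
        · simp
    · simp
  · exact (hw i (ψ i) hi (hgood i hi.le).1 (hgood i hi.le).2).1
  · induction i with
    | zero => intro _; simp [ψ]
    | succ i ih =>
      intro hi
      obtain ⟨-, -, h, -⟩ := hw i (ψ i) (by omega) (hgood i (by omega)).1 (hgood i (by omega)).2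
      change w i (ψ i) (i + 1) = _
      -- Since `d (i + 1) + 1 = d i + p (i + 1)`, the factor `b ^ d i` of the diagonal entry leaves
      -- exactly the coefficient of `b ^ p (i + 1)` in `S (i + 1)`.
      rw [h, ih (by omega), hd i (by omega), add_comm (d i), ← mul_assoc,
        PowerSeries.coeff_mul_X_pow, PowerSeries.coeff_mul_C, Finset.prod_range_succ, mul_comm]
      rw [mul_comm (PowerSeries.coeff _ _)]
      rw [mul_comm]

/-- A chain in `Ξ_λ^{(n)}` that is triangular with respect to the basis `e_{λ,j}`. -/
structure IsTriangularChain (lam : ℕ → ℚ) (S : ℕ → PowerSeries R) (n : ℕ) {l : ℚ} (c : ℕ → R)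
    (d : ℕ → ℕ) (e : ℕ → Xi R {l} n) : Prop extends IsChain Xi.aMap lam S n e where
  upper : ∀ i ≤ n, ∀ j, i < (j.2 : ℕ) → e i j = 0
  diag : ∀ i ≤ n, ∀ j, (j.2 : ℕ) = i → e i j = PowerSeries.C (c i) * PowerSeries.X ^ d i

/-- Because `λ_{i+1} = l + d_i`, the `l` in the action of `a` cancels and the chain equations become
those in coordinates. -/
theorem exists_isTriangularChain (lam : ℕ → ℚ) (S : ℕ → PowerSeries R) (n : ℕ) (l : ℚ)
    (p d : ℕ → ℕ) (hd : ∀ i < n, d (i + 1) + 1 = d i + p (i + 1)) (hd0 : n ≤ d 0)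
    (hlam : ∀ i ≤ n, lam (i + 1) = l + d i) :
    ∃ e : ℕ → Xi R {l} n, IsTriangularChain lam S n
      (fun i => ∏ t ∈ Finset.range i, PowerSeries.coeff (p (t + 1)) (S (t + 1))) d e := by
  obtain ⟨ψ, h1, h2, h3, h4⟩ := exists_chain_coords n p d S hd hd0
  have key : ∀ i ≤ n, ∀ j : ({l} : Finset ℚ) × Fin (n + 1),
      Xi.aMap (fun j : ({l} : Finset ℚ) × Fin (n + 1) => ψ i (j.2 : ℕ)) j =
      PowerSeries.C (algebraMap ℂ R (lam (i + 1) : ℂ)) * PowerSeries.X * ψ i (j.2 : ℕ) -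
      PowerSeries.C (algebraMap ℂ R (d i)) * PowerSeries.X * ψ i (j.2 : ℕ) +
      (PowerSeries.X ^ 2 * PowerSeries.derivative R (ψ i (j.2 : ℕ)) +
        PowerSeries.X * ψ i (j.2 + 1 : ℕ)) := by
    rintro i hi ⟨⟨q, hq⟩, j⟩
    obtain rfl := Finset.mem_singleton.mp hq
    -- Truncating `Ξ` at logarithmic degree `n` loses nothing: `ψ i` has degree at most `i ≤ n`.
    have hif : (if h : (j : ℕ) + 1 < n + 1 then ψ i ((j : ℕ) + 1) else 0) = ψ i (j + 1 : ℕ) := by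
      split_ifs with h
      · rfl
      · exact (h3 i hi _ (by omega)).symm
    simp only [Xi.aMap]
    rw [hif, hlam i hi]
    push_cast
    simp only [map_add]
    ring
  refine ⟨fun i j => ψ i (j.2 : ℕ), ⟨Xi.aMap_add, Xi.aMap_smul, ?_, ?_⟩, ?_, ?_⟩
  · funext j
    rw [key 0 (Nat.zero_le _), h1]
    simp only [Pi.smul_apply, smul_eq_mul]
    ring
  · intro i hi
    funext j
    rw [key (i + 1) hi, h2 i hi]
    simp only [Pi.smul_apply, Pi.add_apply, smul_eq_mul]
    ring
  · exact fun i hi j hj => h3 i hi _ hj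
  · rintro i hi j rfl
    exact h4 _ hi

variable {lam : ℕ → ℚ} {S : ℕ → PowerSeries R} {n : ℕ} {l : ℚ} {c : ℕ → R} {d : ℕ → ℕ}
  {e : ℕ → Xi R {l} n}

theorem IsTriangularChain.map (he : IsTriangularChain lam S n c d e) {R' : Type*} [CommRing R']
    [Algebra ℂ R'] (g : R →ₐ[ℂ] R') :
    IsTriangularChain lam (fun j => PowerSeries.map (g : R →+* R') (S j)) n (fun i => g (c i)) d
      (fun i => Xi.map (g : R →+* R') (e i)) where
  add := Xi.aMap_add
  leibniz := Xi.aMap_smul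
  zero := by
    rw [← Xi.map_aMap, he.zero, Xi.map_smul]
    simp
  succ i hi := by
    rw [← Xi.map_aMap, he.succ i hi, Xi.map_add, Xi.map_smul, Xi.map_smul]
    simp
  upper i hi j hj := by simp [Xi.map, he.upper i hi j hj]
  diag i hi j hj := by simp [Xi.map, he.diag i hi j hj]

/-- Back substitution from the highest logarithm: the coordinate `i` of a relation reduces to `f_i
c_i b ^ d_i = 0`. It is enough that `c_i` is not a zero divisor, since rings of holomorphic
functions on disconnected open sets have zero divisors. -/
theorem IsTriangularChain.linearIndependent (he : IsTriangularChain lam S n c d e)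
    (hc : ∀ i ≤ n, ∀ r : R, r * c i = 0 → r = 0) :
    LinearIndependent (PowerSeries R) fun i : Fin (n + 1) => e i := by
  rw [Fintype.linearIndependent_iff]
  intro f hf
  have main : ∀ m : ℕ, ∀ i : Fin (n + 1), n - (i : ℕ) = m → f i = 0 := by
    intro m
    induction m using Nat.strong_induction_on with
    | _ m ih =>
      intro i him
      have hi := i.2
      have h1 := congrFun hf (⟨l, Finset.mem_singleton_self l⟩, i)
      rw [Finset.sum_apply, Finset.sum_eq_single i, Pi.smul_apply, smul_eq_mul,
        he.diag i (by omega) _ rfl, ← mul_assoc] at h1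
      · ext N
        refine hc i (by omega) _ ?_
        have h2 := congrArg (PowerSeries.coeff (N + d i)) h1
        rwa [PowerSeries.coeff_mul_X_pow, PowerSeries.coeff_mul_C] at h2
      · intro j _ hj
        rcases lt_or_gt_of_ne hj with h | h
        · rw [Pi.smul_apply, he.upper j (by omega) _ h, smul_zero]
        · rw [ih (n - (j : ℕ)) (by have := j.2; have : (i : ℕ) < j := h; omega) j rfl, zero_smul]
          rfl
      · simp
  exact fun i => main _ i rfl

end XiChain

/-! ### Linearity and continuity of `a` on the cyclic module -/

section Cyc

variable {R : Type*} [CommRing R] {P : ATilde R}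

theorem Cyc.aAct_C_smul (r : R) (s : Cyc R P) :
    Cyc.aAct P ((PowerSeries.C r : PowerSeries R) • s) =
      (PowerSeries.C r : PowerSeries R) • Cyc.aAct P s := by
  rw [Cyc.aAct_smul, PowerSeries.derivative_C, mul_zero, zero_smul, add_zero]

theorem Cyc.aAct_X_pow_smul (n : ℕ) (s : Cyc R P) :
    Cyc.aAct P ((PowerSeries.X ^ n : PowerSeries R) • s) = (PowerSeries.X ^ n : PowerSeries R) •
      (Cyc.aAct P s + ((n : PowerSeries R) * PowerSeries.X) • s) := by
  rw [Cyc.aAct_smul, smul_add, smul_smul]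
  congr 2
  cases n with
  | zero => simp
  | succ n =>
    rw [Derivation.leibniz_pow, PowerSeries.derivative_X]
    simp only [nsmul_eq_mul, smul_eq_mul, Nat.add_sub_cancel]
    ring

theorem Cyc.aAct_X_smul_sub (s : Cyc R P) :
    Cyc.aAct P ((PowerSeries.X : PowerSeries R) • s) - (PowerSeries.X : PowerSeries R) •
      Cyc.aAct P s = (PowerSeries.X ^ 2 : PowerSeries R) • s := by
  rw [sub_eq_iff_eq_add', Cyc.aAct_smul, PowerSeries.derivative_X, mul_one]

end Cyc

/-! ### The sheaf of holomorphic functions -/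

section Hol

variable {E X : Type*} [NormedAddCommGroup E] [NormedSpace ℂ E] [TopologicalSpace X]
  [ChartedSpace E X]

theorem Hol.res_apply {V W : Opens X} (h : W ≤ V) (f : Hol E V) (x : W) :
    Hol.res E h f x = f ⟨x, h x.2⟩ := rfl

theorem Hol.glue {I : Type*} (U : I → Opens X) (f : ∀ i, Hol E (U i))
    (hf : ∀ i j, Hol.res E (inf_le_left : U i ⊓ U j ≤ U i) (f i) =
      Hol.res E (inf_le_right : U i ⊓ U j ≤ U j) (f j)) :
    ∃ g : Hol E (iSup U), ∀ i, Hol.res E (le_iSup U i) g = f i := by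
  classical
  have hI : ∀ x : (iSup U : Opens X), ∃ i, (x : X) ∈ U i := fun x => Opens.mem_iSup.mp x.2
  choose ι hι using hI
  have hval : ∀ (x : (iSup U : Opens X)) (i : I) (hx : (x : X) ∈ U i),
      f (ι x) ⟨x, hι x⟩ = f i ⟨x, hx⟩ := fun x i hx =>
    DFunLike.congr_fun (hf (ι x) i) ⟨x, hι x, hx⟩
  -- Extending by zero to `X` gives one function whose holomorphy can be compared between the two
  -- open subsets; the value outside is irrelevant.
  let G : X → ℂ := fun y => if h : y ∈ iSup U then f (ι ⟨y, h⟩) ⟨y, hι ⟨y, h⟩⟩ else 0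
  have hG : ∀ (i : I) (y : U i), G y = f i y := by
    intro i y
    have hy : (y : X) ∈ iSup U := le_iSup U i y.2
    simp only [G, dif_pos hy]
    exact hval ⟨y, hy⟩ i y.2
  refine ⟨⟨fun x => G x, fun x => ?_⟩, fun i => ?_⟩
  · rw [contMDiffAt_subtype_iff]
    obtain ⟨i, hi⟩ := Opens.mem_iSup.mp x.2
    have h1 : ContMDiffAt 𝓘(ℂ, E) 𝓘(ℂ, ℂ) ω (fun y : U i => G y) ⟨x, hi⟩ := by
      rw [show (fun y : U i => G y) = f i from funext (hG i)]
      exact (f i).contMDiff _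
    exact (contMDiffAt_subtype_iff (x := (⟨x, hi⟩ : U i))).mp h1
  · ext y
    exact hG i y

theorem HolB.coeff_res {V W : Opens X} (h : W ≤ V) (f : HolB E V) (n : ℕ) :
    PowerSeries.coeff n (HolB.res h f) = Hol.res E h (PowerSeries.coeff n f) :=
  PowerSeries.coeff_map _ _ _

theorem HolB.res_self {V : Opens X} (f : HolB E V) : HolB.res (le_refl V) f = f := by
  ext n x
  rw [HolB.coeff_res, Hol.res_apply]

theorem HolB.res_res {U V W : Opens X} (h : V ≤ U) (h' : W ≤ V) (f : HolB E U) :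
    HolB.res h' (HolB.res h f) = HolB.res (h'.trans h) f := by
  ext n x
  simp only [HolB.coeff_res, Hol.res_apply]

theorem HolB.separated {V : Opens X} (f g : HolB E V)
    (H : ∀ x ∈ V, ∃ (W : Opens X) (h : W ≤ V), x ∈ W ∧ HolB.res h f = HolB.res h g) :
    f = g := by
  ext n x
  obtain ⟨W, h, hx, hW⟩ := H x x.2
  have := congrArg (fun u : HolB E W => PowerSeries.coeff n u ⟨x, hx⟩) hW
  simpa only [HolB.coeff_res, Hol.res_apply] using this

theorem HolB.glue {I : Type*} (U : I → Opens X) (f : ∀ i, HolB E (U i))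
    (hf : ∀ i j, HolB.res (inf_le_left : U i ⊓ U j ≤ U i) (f i) =
      HolB.res (inf_le_right : U i ⊓ U j ≤ U j) (f j)) :
    ∃ g : HolB E (iSup U), ∀ i, HolB.res (le_iSup U i) g = f i := by
  have key : ∀ n, ∃ g : Hol E (iSup U), ∀ i,
      Hol.res E (le_iSup U i) g = PowerSeries.coeff n (f i) := fun n =>
    Hol.glue U (fun i => PowerSeries.coeff n (f i)) fun i j => by
      rw [← HolB.coeff_res, hf, HolB.coeff_res]
  choose g hg using key
  refine ⟨PowerSeries.mk g, fun i => ?_⟩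
  ext n : 1
  rw [HolB.coeff_res, PowerSeries.coeff_mk, hg]

theorem HolB.eval_res {V W : Opens X} (h : W ≤ V) (x : X) (hx : x ∈ W) (f : HolB E V) :
    HolB.eval (⟨x, hx⟩ : W) (HolB.res h f) = HolB.eval (⟨x, h hx⟩ : V) f := by
  ext n
  simp only [HolB.eval, PowerSeries.coeff_map, HolB.coeff_res]
  rfl

end Hol

/-! ### The canonical family is a sheaf of `(a,b)`-modules -/

section Canonical

variable {k : ℕ} {p : ℕ → ℕ} (lam1 : ℚ)

/-- The basis `1, a, …, a ^ (k - 1)` of the sections of the canonical family. -/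
noncomputable def canonBasis (V : Opens (paramOpens k p)) :
    Module.Basis (Fin (k - 1 + 1)) (HolB (CoordIdx k p → ℂ) V)
      (Cyc (Hol (CoordIdx k p → ℂ) V) (canonPOn lam1 V)) :=
  Cyc.powBasis _ _ (coeff_zero_series_thetaP _ _ _)

theorem canonBasis_apply (V : Opens (paramOpens k p)) (i : Fin (k - 1 + 1)) :
    canonBasis lam1 V i = Submodule.Quotient.mk (ATilde.a _ ^ (i : ℕ)) :=
  Cyc.powBasis_apply _ _ _ _

theorem canonRes_smul {V W : Opens (paramOpens k p)} (h : W ≤ V)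
    (f : HolB (CoordIdx k p → ℂ) V) (s : Cyc (Hol (CoordIdx k p → ℂ) V) (canonPOn lam1 V)) :
    canonRes lam1 h (f • s) = HolB.res h f • canonRes lam1 h s :=
  Cyc.map_smul _ _ _ _

theorem canonBasis_repr_res {V W : Opens (paramOpens k p)} (h : W ≤ V)
    (s : Cyc (Hol (CoordIdx k p → ℂ) V) (canonPOn lam1 V)) (i : Fin (k - 1 + 1)) :
    (canonBasis lam1 W).repr (canonRes lam1 h s) i = HolB.res h ((canonBasis lam1 V).repr s i) :=
  Cyc.powBasis_repr_map _ _ _ _ _ _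

theorem canonRes_canonBasis {V W : Opens (paramOpens k p)} (h : W ≤ V) (i : Fin (k - 1 + 1)) :
    canonRes lam1 h (canonBasis lam1 V i) = canonBasis lam1 W i := by
  rw [canonBasis_apply, canonBasis_apply, canonRes, Cyc.map_mk, map_pow, ATilde.map_a]

theorem canon_ext {V : Opens (paramOpens k p)}
    {s t : Cyc (Hol (CoordIdx k p → ℂ) V) (canonPOn lam1 V)}
    (h : ∀ i, (canonBasis lam1 V).repr s i = (canonBasis lam1 V).repr t i) : s = t :=
  (canonBasis lam1 V).repr.injective (Finsupp.ext h)

theorem canon_separated (V : Opens (paramOpens k p))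
    (s t : Cyc (Hol (CoordIdx k p → ℂ) V) (canonPOn lam1 V))
    (H : ∀ x ∈ V, ∃ (W : Opens (paramOpens k p)) (h : W ≤ V), x ∈ W ∧
      canonRes lam1 h s = canonRes lam1 h t) : s = t := by
  refine canon_ext lam1 fun i => HolB.separated _ _ fun x hx => ?_
  obtain ⟨W, h, hxW, hW⟩ := H x hx
  exact ⟨W, h, hxW, by rw [← canonBasis_repr_res, hW, canonBasis_repr_res]⟩

theorem canonRes_res {U V W : Opens (paramOpens k p)} (h : V ≤ U) (h' : W ≤ V)
    (s : Cyc (Hol (CoordIdx k p → ℂ) U) (canonPOn lam1 U)) :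
    canonRes lam1 h' (canonRes lam1 h s) = canonRes lam1 (h'.trans h) s := by
  refine canon_ext lam1 fun i => ?_
  simp only [canonBasis_repr_res, HolB.res_res]

theorem canon_glue {I : Type*} (U : I → Opens (paramOpens k p))
    (s : ∀ i, Cyc (Hol (CoordIdx k p → ℂ) (U i)) (canonPOn lam1 (U i)))
    (hs : ∀ i j, canonRes lam1 (inf_le_left : U i ⊓ U j ≤ U i) (s i) =
      canonRes lam1 (inf_le_right : U i ⊓ U j ≤ U j) (s j)) :
    ∃ t : Cyc (Hol (CoordIdx k p → ℂ) (iSup U)) (canonPOn lam1 (iSup U)),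
      ∀ i, canonRes lam1 (le_iSup U i) t = s i := by
  have key : ∀ m, ∃ g : HolB (CoordIdx k p → ℂ) (iSup U), ∀ i,
      HolB.res (le_iSup U i) g = (canonBasis lam1 (U i)).repr (s i) m := fun m =>
    HolB.glue U _ fun i j => by
      rw [← canonBasis_repr_res, hs, canonBasis_repr_res]
  choose g hg using key
  refine ⟨(canonBasis lam1 (iSup U)).equivFun.symm g, fun i => canon_ext lam1 fun m => ?_⟩
  rw [canonBasis_repr_res, ← Module.Basis.equivFun_apply, LinearEquiv.apply_symm_apply, hg]

theorem isABSheaf_canonicalFamily (k : ℕ) (lam1 : ℚ) (p : ℕ → ℕ) :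
    IsABSheaf (canonicalFamily k lam1 p) where
  res_self V s := canon_ext lam1 fun i => by
    rw [← HolB.res_self ((canonBasis lam1 V).repr s i)]
    exact canonBasis_repr_res lam1 le_rfl s i
  res_res h h' s := canonRes_res lam1 h h' s
  res_smul h f s := canonRes_smul lam1 h f s
  separated V s t H := canon_separated lam1 V s t H
  glue U s hs := canon_glue lam1 U s hs
  locally_free x := by
    refine ⟨⊤, k - 1 + 1, canonBasis lam1 ⊤, trivial, fun V h => ?_⟩
    have : (fun i => (canonicalFamily k lam1 p).res h (canonBasis lam1 ⊤ i)) =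
        canonBasis lam1 V := funext fun i => canonRes_canonBasis lam1 h i
    rw [this]
    exact ⟨(canonBasis lam1 V).linearIndependent, (canonBasis lam1 V).span_eq⟩
  res_aMap h s := Cyc.map_aAct _ (map_res_canonPOn lam1 h) s
  aMap_C_smul _ f s := Cyc.aAct_C_smul f s
  aMap_continuous _ n := ⟨n, fun s => ⟨_, Cyc.aAct_X_pow_smul n s⟩⟩
  aMap_b _ s := Cyc.aAct_X_smul_sub s

/-! ### Fibres of the canonical family -/

theorem map_eval_tautSeries {V : Opens (paramOpens k p)} (x : V) (j : ℕ) :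
    PowerSeries.map (Hol.eval (CoordIdx k p → ℂ) x : Hol (CoordIdx k p → ℂ) V →+* ℂ)
      (tautSeries V j) = seriesOf ((x : paramOpens k p) : CoordIdx k p → ℂ) j := by
  ext n
  rw [PowerSeries.coeff_map, tautSeries, PowerSeries.coeff_mk]
  rfl

theorem map_eval_canonPOn {V : Opens (paramOpens k p)} (x : V) :
    ATilde.map (Hol.eval (CoordIdx k p → ℂ) x : Hol (CoordIdx k p → ℂ) V →+* ℂ)
      (canonPOn lam1 V) = canonP lam1 (x : paramOpens k p) := by
  rw [canonPOn, map_thetaP _ _ _ (constantCoeff_tautSeries V), canonP]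
  congr 1
  exact funext fun j => map_eval_tautSeries x j

/-- The basis `1, a, …, a ^ (k - 1)` of `E(σ)`. -/
noncomputable def canonEBasis (σ : paramOpens k p) :
    Module.Basis (Fin (k - 1 + 1)) (PowerSeries ℂ) (canonE lam1 σ) :=
  Cyc.powBasis (canonP lam1 σ) _ (coeff_zero_series_thetaP _ _ _)

/-- Evaluation of sections of the canonical family at a point. -/
noncomputable def canonEval {V : Opens (paramOpens k p)} (x : V) :
    Cyc (Hol (CoordIdx k p → ℂ) V) (canonPOn lam1 V) →+ canonE lam1 (x : paramOpens k p) :=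
  Cyc.map _ (map_eval_canonPOn lam1 x)

theorem canonEBasis_repr_canonEval {V : Opens (paramOpens k p)} (x : V)
    (s : Cyc (Hol (CoordIdx k p → ℂ) V) (canonPOn lam1 V)) (i : Fin (k - 1 + 1)) :
    (canonEBasis lam1 (x : paramOpens k p)).repr (canonEval lam1 x s) i =
      HolB.eval x ((canonBasis lam1 V).repr s i) :=
  Cyc.powBasis_repr_map _ _ _ _ s i

theorem canonEval_smul {V : Opens (paramOpens k p)} (x : V) (f : HolB (CoordIdx k p → ℂ) V)
    (s : Cyc (Hol (CoordIdx k p → ℂ) V) (canonPOn lam1 V)) :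
    canonEval lam1 x (f • s) = HolB.eval x f • canonEval lam1 x s :=
  Cyc.map_smul _ _ f s

theorem canonE_ext {σ : paramOpens k p} {s t : canonE lam1 σ}
    (h : ∀ i, (canonEBasis lam1 σ).repr s i = (canonEBasis lam1 σ).repr t i) : s = t :=
  (canonEBasis lam1 σ).repr.injective (Finsupp.ext h)

theorem canonEval_canonRes {V W : Opens (paramOpens k p)} (h : W ≤ V) {σ : paramOpens k p}
    (hx : σ ∈ W) (s : Cyc (Hol (CoordIdx k p → ℂ) V) (canonPOn lam1 V)) :
    canonEval lam1 (⟨σ, hx⟩ : W) (canonRes lam1 h s) = canonEval lam1 (⟨σ, h hx⟩ : V) s := by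
  refine canonE_ext lam1 fun i => ?_
  refine (canonEBasis_repr_canonEval lam1 (⟨σ, hx⟩ : W) _ i).trans ?_
  rw [canonBasis_repr_res, HolB.eval_res]
  exact (canonEBasis_repr_canonEval lam1 (⟨σ, h hx⟩ : V) _ i).symm

theorem exists_canonEval_eq (σ : paramOpens k p) (m : canonE lam1 σ) :
    ∃ s, canonEval lam1 (⟨σ, trivial⟩ : (⊤ : Opens (paramOpens k p))) s = m := by
  -- Lift the coordinates of `m` to constant functions.
  refine ⟨∑ i, PowerSeries.map
    (algebraMap ℂ (Hol (CoordIdx k p → ℂ) (⊤ : Opens (paramOpens k p))))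
    ((canonEBasis lam1 σ).repr m i) • canonBasis lam1 ⊤ i, canonE_ext lam1 fun i => ?_⟩
  refine (canonEBasis_repr_canonEval lam1
    (⟨σ, trivial⟩ : (⊤ : Opens (paramOpens k p))) _ i).trans ?_
  rw [Module.Basis.repr_sum_self]
  ext n
  simp only [HolB.eval, PowerSeries.coeff_map]
  rfl

/-- Evaluation acts on the coordinates in the power basis, so each coordinate of `s` lies in the
kernel; expanding `s` in that basis concludes, without shrinking `V`. -/
theorem mem_ker_smul_top_of_canonEval_eq_zero {V : Opens (paramOpens k p)} (x : V)
    (s : Cyc (Hol (CoordIdx k p → ℂ) V) (canonPOn lam1 V)) (hs : canonEval lam1 x s = 0) :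
    s ∈ RingHom.ker (HolB.eval (E := CoordIdx k p → ℂ) x) •
      (⊤ : Submodule (HolB (CoordIdx k p → ℂ) V)
      (Cyc (Hol (CoordIdx k p → ℂ) V) (canonPOn lam1 V))) := by
  rw [← (canonBasis lam1 V).sum_repr s]
  refine Submodule.sum_mem _ fun i _ => Submodule.smul_mem_smul ?_ trivial
  rw [RingHom.mem_ker, ← canonEBasis_repr_canonEval, hs]
  simp

theorem canonEval_eq_zero_of_mem {V : Opens (paramOpens k p)} (x : V)
    (s : Cyc (Hol (CoordIdx k p → ℂ) V) (canonPOn lam1 V))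
    (hs : s ∈ RingHom.ker (HolB.eval (E := CoordIdx k p → ℂ) x) •
      (⊤ : Submodule (HolB (CoordIdx k p → ℂ) V)
      (Cyc (Hol (CoordIdx k p → ℂ) V) (canonPOn lam1 V)))) : canonEval lam1 x s = 0 := by
  refine Submodule.smul_induction_on hs ?_ ?_
  · intro f hf t _
    rw [canonEval_smul, RingHom.mem_ker.mp hf, zero_smul]
  · intro s t hs ht
    rw [map_add, hs, ht, add_zero]

theorem isFibre_canonicalFamily (σ : paramOpens k p) :
    IsFibre (canonicalFamily k lam1 p) σ (canonE lam1 σ) (Cyc.aAct (canonP lam1 σ)) := by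
  refine ⟨fun V hV => canonEval lam1 (⟨σ, hV⟩ : V),
    fun V W h hx s => canonEval_canonRes lam1 h hx s,
    fun V hV f s => canonEval_smul lam1 (⟨σ, hV⟩ : V) f s,
    fun V hx s => Cyc.map_aAct _ (map_eval_canonPOn lam1 (⟨σ, hx⟩ : V)) s,
    fun m => ⟨⊤, trivial, exists_canonEval_eq lam1 σ m⟩,
    fun V hx s => ⟨fun h0 => ⟨V, le_rfl, hx, ?_⟩, ?_⟩⟩
  · rw [(isABSheaf_canonicalFamily k lam1 p).res_self V s]
    exact mem_ker_smul_top_of_canonEval_eq_zero lam1 (⟨σ, hx⟩ : V) s h0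
  · rintro ⟨W, h, hxW, hW⟩
    exact (canonEval_canonRes lam1 h hxW s).symm.trans
      (canonEval_eq_zero_of_mem lam1 (⟨σ, hxW⟩ : W) _ hW)

end Canonical

/-! ### The parameter space in coordinates -/

/-- If `p_j ≥ k - j`, the minimal `h` is `0` and `q_j = p_j`; otherwise `p_j` is among the small
exponents. Hence the nonvanishing condition concerns a genuine coordinate when `p_j ≠ 0`. -/
theorem mem_expV {k : ℕ} {p : ℕ → ℕ} {j : ℕ} (hj : j ∈ Finset.Icc 1 (k - 1)) :
    p j ∈ expV k p j := by
  rw [Finset.mem_Icc] at hj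
  have hle : p j ≤ ∑ i ∈ Finset.Icc j (k - 1), p i :=
    Finset.single_le_sum (fun _ _ => Nat.zero_le _) (Finset.mem_Icc.mpr ⟨le_rfl, hj.2⟩)
  unfold expV
  split_ifs with h
  · exact Finset.mem_range.mpr (by omega)
  · by_cases hp : p j < k - j
    · exact Finset.mem_insert_of_mem (Finset.mem_range.mpr hp)
    · have : sInf {h | k - j ≤ ∑ i ∈ Finset.Icc j (j + h), p i} = 0 :=
        Nat.sInf_eq_zero.mpr (Or.inl (by simpa using hp))
      rw [this]
      simp

theorem coeff_seriesOf_coord {k : ℕ} {p : ℕ → ℕ} (s : CoordIdx k p → ℂ) (i : CoordIdx k p) :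
    PowerSeries.coeff i.1.2 (seriesOf s i.1.1) = s i := by
  obtain ⟨⟨j, n⟩, h⟩ := i
  have hn : n ≠ 0 := (Finset.mem_erase.mp (Finset.mem_sigma.mp h).2).1
  simp only [seriesOf, PowerSeries.coeff_mk, if_neg hn, dif_pos h]

theorem mem_paramOpens_iff {k : ℕ} {p : ℕ → ℕ} (s : CoordIdx k p → ℂ) :
    s ∈ paramOpens k p ↔ ∀ i : CoordIdx k p, i.1.2 = p i.1.1 → s i ≠ 0 := by
  change (∀ j ∈ Finset.Icc 1 (k - 1), PowerSeries.coeff (p j) (seriesOf s j) ≠ 0) ↔ _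
  constructor
  · intro h i hi
    rw [← coeff_seriesOf_coord s i, hi]
    exact h _ (Finset.mem_sigma.mp i.2).1
  · intro h j hj
    -- For `p j = 0` the coefficient is the constant term `1`, so there is no condition.
    by_cases hp : p j = 0
    · rw [hp]
      simp [seriesOf]
    · have hmem : (⟨j, p j⟩ : Σ _ : ℕ, ℕ) ∈
          (Finset.Icc 1 (k - 1)).sigma fun j => (expV k p j).erase 0 :=
        Finset.mem_sigma.mpr ⟨hj, Finset.mem_erase.mpr ⟨hp, mem_expV hj⟩⟩
      exact (coeff_seriesOf_coord s ⟨_, hmem⟩).symm ▸ h ⟨_, hmem⟩ rfl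

/-- Up to a permutation of the coordinates, the parameter space is `ℂ^m × (ℂ^*)^n`. -/
theorem exists_equiv_mem_paramOpens_iff (k : ℕ) (p : ℕ → ℕ) :
    ∃ (m n : ℕ) (r : Fin m ⊕ Fin n ≃ CoordIdx k p), ∀ s : CoordIdx k p → ℂ,
      s ∈ paramOpens k p ↔ ∀ i : Fin n, s (r (Sum.inr i)) ≠ 0 := by
  classical
  let e₁ := Fintype.equivFin {i : CoordIdx k p // ¬ i.1.2 = p i.1.1}
  let e₂ := Fintype.equivFin {i : CoordIdx k p // i.1.2 = p i.1.1}
  refine ⟨_, _, (Equiv.sumCongr e₁.symm e₂.symm).trans ((Equiv.sumComm _ _).trans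
    (Equiv.sumCompl fun i : CoordIdx k p => i.1.2 = p i.1.1)), fun s => ?_⟩
  rw [mem_paramOpens_iff]
  constructor
  · intro h i
    exact h _ (e₂.symm i).2
  · intro h i hi
    have := h (e₂ ⟨i, hi⟩)
    simpa using this

/-! ### The exponents -/

/-- The numbers `d_0 = m`, `d_{i+1} = d_i + p_{i+1} - 1`. -/
def shiftSeq (m : ℕ) (p : ℕ → ℕ) : ℕ → ℕ
  | 0 => m
  | i + 1 => shiftSeq m p i + p (i + 1) - 1

/-- Each step lowers the sequence by at most one. Starting at `m ≥ n`, it stays positive before step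
`n`, so the truncated subtraction in `shiftSeq` is the true one in that range. -/
theorem le_shiftSeq {m n : ℕ} (p : ℕ → ℕ) (hm : n ≤ m) (i : ℕ) : n - i ≤ shiftSeq m p i := by
  induction i with
  | zero => exact hm
  | succ i ih => rw [shiftSeq]; omega

theorem shiftSeq_succ_add_one {m n : ℕ} (p : ℕ → ℕ) (hm : n ≤ m) {i : ℕ} (hi : i < n) :
    shiftSeq m p (i + 1) + 1 = shiftSeq m p i + p (i + 1) := by
  have := le_shiftSeq p hm i
  rw [shiftSeq]
  omega

theorem lamSeq_eq_add_shiftSeq {m n : ℕ} (p : ℕ → ℕ) (hm : n ≤ m) {lam1 l : ℚ}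
    (h : lam1 = l + m) {i : ℕ} (hi : i ≤ n) : lamSeq lam1 p (i + 1) = l + shiftSeq m p i := by
  induction i with
  | zero => exact h
  | succ i ih =>
    have h1 : ((shiftSeq m p (i + 1) : ℕ) : ℚ) + 1 = shiftSeq m p i + p (i + 1) := by
      exact_mod_cast shiftSeq_succ_add_one p hm hi
    rw [lamSeq, ih (by omega)]
    linarith

/-- Take `m = ⌈λ_1⌉ - 1`, the choice that puts `l` in `]0, 1]`. The bound `λ_1 > k - 1` becomes `m ≥
k - 1`, the room needed for the `k - 1` steps of the chain. -/
theorem exists_eq_add_natCast {k : ℕ} (hk : 1 ≤ k) {lam1 : ℚ} (hlam : (k : ℚ) - 1 < lam1) :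
    ∃ (l : ℚ) (m : ℕ), 0 < l ∧ l ≤ 1 ∧ k - 1 ≤ m ∧ lam1 = l + m := by
  have h1 : (k : ℤ) - 1 < ⌈lam1⌉ := by
    rw [Int.lt_ceil]
    push_cast
    exact hlam
  obtain ⟨m, hm⟩ : ∃ m : ℕ, (m : ℤ) = ⌈lam1⌉ - 1 := ⟨(⌈lam1⌉ - 1).toNat, by omega⟩
  have hm' : (m : ℚ) = ⌈lam1⌉ - 1 := by exact_mod_cast hm
  have h2 := Int.le_ceil lam1
  have h3 := Int.ceil_lt_add_one lam1
  exact ⟨lam1 - m, m, by linarith, by linarith, by omega, by ring⟩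

/-! ### The fibres as primitive themes -/

theorem prod_coeff_seriesOf_ne_zero {k : ℕ} {p : ℕ → ℕ} (σ : paramOpens k p) {i : ℕ}
    (hi : i ≤ k - 1) : ∏ t ∈ Finset.range i,
      PowerSeries.coeff (p (t + 1)) (seriesOf (σ : CoordIdx k p → ℂ) (t + 1)) ≠ 0 := by
  refine Finset.prod_ne_zero_iff.mpr fun t ht => σ.2 (t + 1) ?_
  rw [Finset.mem_range] at ht
  exact Finset.mem_Icc.mpr ⟨by omega, by omega⟩

theorem constantCoeff_seriesOf {k : ℕ} {p : ℕ → ℕ} (s : CoordIdx k p → ℂ) (j : ℕ) :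
    PowerSeries.constantCoeff (seriesOf s j) = 1 := by
  rw [← PowerSeries.coeff_zero_eq_constantCoeff_apply]
  simp [seriesOf]

/-- The fibres of the canonical family are primitive themes. -/
theorem isPrimitiveTheme_canonE {k : ℕ} (hk : 1 ≤ k) {lam1 : ℚ} (hlam : (k : ℚ) - 1 < lam1)
    {p : ℕ → ℕ} (σ : paramOpens k p) :
    IsPrimitiveTheme lam1 k (canonE lam1 σ) (Cyc.aAct (canonP lam1 σ)) := by
  obtain ⟨l, m, hl0, hl1, hm, hlm⟩ := exists_eq_add_natCast hk hlam
  have hS := constantCoeff_seriesOf (σ : CoordIdx k p → ℂ)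
  obtain ⟨e, he⟩ := exists_isTriangularChain (R := ℂ) (lamSeq lam1 p)
    (seriesOf (σ : CoordIdx k p → ℂ)) (k - 1) l p (shiftSeq m p)
    (fun i hi => shiftSeq_succ_add_one p hm hi) hm
    (fun i hi => lamSeq_eq_add_shiftSeq p hm hlm hi)
  have hli := he.linearIndependent fun i hi r hr =>
    (mul_eq_zero.mp hr).resolve_right (prod_coeff_seriesOf_ne_zero σ hi)
  refine ⟨⟨(canonEBasis lam1 σ).reindex (finCongr (Nat.sub_add_cancel hk))⟩,
    ⟨Submodule.Quotient.mk 1, ?_⟩, l, k - 1, chainMap _ _ _ hS e, hl0, hl1, ⟨m, ?_⟩,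
    chainMap_injective hS hli, chainMap_aAct hS he.toIsChain⟩
  · have := (isChain_tailClass (lamSeq lam1 p) (seriesOf (σ : CoordIdx k p → ℂ)) (k - 1) hS
      ).span_iterate hS
    rw [span_tailClass hS, tailClass_self] at this
    exact this
  · exact_mod_cast hlm

/-! ### The canonical family is a holomorphic family of themes -/

section Family

theorem Xi.res_res {E X : Type*} [NormedAddCommGroup E] [NormedSpace ℂ E] [TopologicalSpace X]
    [ChartedSpace E X] {Λ : Finset ℚ} {N : ℕ} {U V W : Opens X} (h : V ≤ U) (h' : W ≤ V)
    (v : Xi (Hol E U) Λ N) : Xi.res h' (Xi.res h v) = Xi.res (h'.trans h) v :=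
  funext fun i => HolB.res_res h h' (v i)

theorem Xi.res_self {E X : Type*} [NormedAddCommGroup E] [NormedSpace ℂ E] [TopologicalSpace X]
    [ChartedSpace E X] {Λ : Finset ℚ} {N : ℕ} {V : Opens X} (v : Xi (Hol E V) Λ N) :
    Xi.res (le_refl V) v = v :=
  funext fun i => HolB.res_self (v i)

theorem Xi.map_iterate_aMap {R R' : Type*} [CommRing R] [CommRing R'] [Algebra ℂ R] [Algebra ℂ R']
    {Λ : Finset ℚ} {N : ℕ} (g : R →ₐ[ℂ] R') (v : Xi R Λ N) (ν : ℕ) :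
    Xi.map (g : R →+* R') (Xi.aMap^[ν] v) = Xi.aMap^[ν] (Xi.map (g : R →+* R') v) :=
  (Function.Semiconj.iterate_right (f := Xi.map (g : R →+* R'))
    (fun v => Xi.map_aMap g v) ν) v

theorem Xi.separated {E X : Type*} [NormedAddCommGroup E] [NormedSpace ℂ E] [TopologicalSpace X]
    [ChartedSpace E X] {Λ : Finset ℚ} {N : ℕ} {V : Opens X} (v w : Xi (Hol E V) Λ N)
    (H : ∀ x ∈ V, ∃ (W : Opens X) (h : W ≤ V), x ∈ W ∧ Xi.res h v = Xi.res h w) : v = w :=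
  funext fun i => HolB.separated _ _ fun x hx => by
    obtain ⟨W, h, hxW, hW⟩ := H x hx
    exact ⟨W, h, hxW, congrFun hW i⟩

variable {k : ℕ} {p : ℕ → ℕ} {lam1 : ℚ} {l : ℚ} {d : ℕ → ℕ}
  {e : ℕ → Xi (Hol (CoordIdx k p → ℂ) (⊤ : Opens (paramOpens k p))) {l} (k - 1)}

/-- The product of the coefficients of `b ^ {p_t}` in the tautological series `S_t`, `t ≤ i`. -/
noncomputable def tautProd (V : Opens (paramOpens k p)) (i : ℕ) : Hol (CoordIdx k p → ℂ) V :=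
  ∏ t ∈ Finset.range i, PowerSeries.coeff (p (t + 1)) (tautSeries V (t + 1))

theorem eval_tautProd {V : Opens (paramOpens k p)} (x : V) (i : ℕ) :
    Hol.eval (CoordIdx k p → ℂ) x (tautProd V i) = ∏ t ∈ Finset.range i,
      PowerSeries.coeff (p (t + 1))
        (seriesOf ((x : paramOpens k p) : CoordIdx k p → ℂ) (t + 1)) := by
  rw [tautProd, map_prod]
  refine Finset.prod_congr rfl fun t _ => ?_
  rw [tautSeries, PowerSeries.coeff_mk]
  rfl

theorem eq_zero_of_mul_tautProd_eq_zero {V : Opens (paramOpens k p)} {i : ℕ} (hi : i ≤ k - 1)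
    (r : Hol (CoordIdx k p → ℂ) V) (h : r * tautProd V i = 0) : r = 0 := by
  ext x
  have h1 := congrArg (Hol.eval (CoordIdx k p → ℂ) x) h
  rw [map_mul, map_zero, eval_tautProd] at h1
  exact (mul_eq_zero.mp h1).resolve_right (prod_coeff_seriesOf_ne_zero _ hi)

theorem map_res_tautSeries {V W : Opens (paramOpens k p)} (h : W ≤ V) (j : ℕ) :
    PowerSeries.map (Hol.res (CoordIdx k p → ℂ) h :
      Hol (CoordIdx k p → ℂ) V →+* Hol (CoordIdx k p → ℂ) W) (tautSeries V j) =
      tautSeries W j := by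
  ext n
  rw [PowerSeries.coeff_map, tautSeries, tautSeries, PowerSeries.coeff_mk, PowerSeries.coeff_mk]
  rfl

theorem res_tautProd {V W : Opens (paramOpens k p)} (h : W ≤ V) (i : ℕ) :
    Hol.res (CoordIdx k p → ℂ) h (tautProd V i) = tautProd W i := by
  rw [tautProd, map_prod]
  refine Finset.prod_congr rfl fun t _ => ?_
  rw [← map_res_tautSeries h, PowerSeries.coeff_map]
  rfl

/-- The chain is built once over the whole parameter space and then restricted, which makes the
morphisms on different open sets compatible. -/
theorem isTriangularChain_res
    (he : IsTriangularChain (lamSeq lam1 p) (tautSeries ⊤) (k - 1) (tautProd ⊤) d e)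
    (V : Opens (paramOpens k p)) :
    IsTriangularChain (lamSeq lam1 p) (tautSeries V) (k - 1) (tautProd V) d
      (fun i => Xi.res (le_top : V ≤ ⊤) (e i)) := by
  have := he.map (Hol.res (CoordIdx k p → ℂ) (le_top : V ≤ ⊤))
  simp only [map_res_tautSeries, res_tautProd] at this
  exact this

theorem linearIndependent_res
    (he : IsTriangularChain (lamSeq lam1 p) (tautSeries ⊤) (k - 1) (tautProd ⊤) d e)
    (V : Opens (paramOpens k p)) :
    LinearIndependent (HolB (CoordIdx k p → ℂ) V)
      (fun i : Fin (k - 1 + 1) => Xi.res (le_top : V ≤ ⊤) (e i)) :=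
  (isTriangularChain_res he V).linearIndependent fun _ hi => eq_zero_of_mul_tautProd_eq_zero hi

variable (lam1 e) in
/-- The morphism from the canonical family to `Ξ_λ^{(k-1)}` defined by a chain. -/
noncomputable def canonMap (V : Opens (paramOpens k p)) :
    Cyc (Hol (CoordIdx k p → ℂ) V) (canonPOn lam1 V) →ₗ[HolB (CoordIdx k p → ℂ) V]
      Xi (Hol (CoordIdx k p → ℂ) V) {l} (k - 1) :=
  chainMap (lamSeq lam1 p) (tautSeries V) (k - 1) (constantCoeff_tautSeries V)
    (fun i => Xi.res (le_top : V ≤ ⊤) (e i))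

theorem canonMap_aAct
    (he : IsTriangularChain (lamSeq lam1 p) (tautSeries ⊤) (k - 1) (tautProd ⊤) d e)
    (V : Opens (paramOpens k p))
    (s : Cyc (Hol (CoordIdx k p → ℂ) V) (canonPOn lam1 V)) :
    canonMap lam1 e V (Cyc.aAct _ s) = Xi.aMap (canonMap lam1 e V s) :=
  chainMap_aAct _ (isTriangularChain_res he V).toIsChain s

theorem canonMap_injective
    (he : IsTriangularChain (lamSeq lam1 p) (tautSeries ⊤) (k - 1) (tautProd ⊤) d e)
    (V : Opens (paramOpens k p)) :
    Function.Injective (canonMap lam1 e V) :=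
  chainMap_injective _ (linearIndependent_res he V)

theorem range_canonMap
    (he : IsTriangularChain (lamSeq lam1 p) (tautSeries ⊤) (k - 1) (tautProd ⊤) d e)
    (V : Opens (paramOpens k p)) :
    LinearMap.range (canonMap lam1 e V) = Submodule.span (HolB (CoordIdx k p → ℂ) V)
      (Set.range fun i : Fin (k - 1 + 1) => Xi.aMap^[(i : ℕ)]
        (Xi.res (le_top : V ≤ ⊤) (e (k - 1)))) :=
  (range_chainMap _).trans
    ((isTriangularChain_res he V).span_iterate_fin (constantCoeff_tautSeries V)).symm

theorem range_canonMap_eq_orbitSpan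
    (he : IsTriangularChain (lamSeq lam1 p) (tautSeries ⊤) (k - 1) (tautProd ⊤) d e)
    (V : Opens (paramOpens k p)) :
    LinearMap.range (canonMap lam1 e V) =
      Xi.orbitSpan (Xi.res (le_top : V ≤ ⊤) (e (k - 1))) :=
  (range_chainMap _).trans
    ((isTriangularChain_res he V).span_iterate (constantCoeff_tautSeries V)).symm

theorem canonMap_canonBasis
    (he : IsTriangularChain (lamSeq lam1 p) (tautSeries ⊤) (k - 1) (tautProd ⊤) d e)
    (V : Opens (paramOpens k p)) (i : Fin (k - 1 + 1)) :
    canonMap lam1 e V (canonBasis lam1 V i) =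
      Xi.aMap^[(i : ℕ)] (Xi.res (le_top : V ≤ ⊤) (e (k - 1))) := by
  have h0 : canonMap lam1 e V (Submodule.Quotient.mk 1) =
      Xi.res (le_top : V ≤ ⊤) (e (k - 1)) := by
    have h1 := chainMap_tailClass (lam := lamSeq lam1 p) (n := k - 1)
      (e := fun i => Xi.res (le_top : V ≤ ⊤) (e i)) (constantCoeff_tautSeries V) le_rfl
    rw [tailClass_self] at h1
    exact h1
  rw [canonBasis_apply, ← Cyc.iterate_aAct_one, ← h0]
  exact (Function.Semiconj.iterate_right (f := canonMap lam1 e V) (canonMap_aAct he V) i) _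

/-- On the basis `a ^ i` both sides are iterates of `a` on restrictions of the single section `e (k
- 1)`, and `a` commutes with restriction. -/
theorem canonMap_canonRes
    (he : IsTriangularChain (lamSeq lam1 p) (tautSeries ⊤) (k - 1) (tautProd ⊤) d e)
    {V W : Opens (paramOpens k p)} (h : W ≤ V)
    (s : Cyc (Hol (CoordIdx k p → ℂ) V) (canonPOn lam1 V)) :
    canonMap lam1 e W (canonRes lam1 h s) = Xi.res h (canonMap lam1 e V s) := by
  have hs : s ∈ Submodule.span (HolB (CoordIdx k p → ℂ) V) (Set.range (canonBasis lam1 V)) := by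
    rw [Module.Basis.span_eq]; trivial
  induction hs using Submodule.span_induction with
  | mem x hx =>
    obtain ⟨i, rfl⟩ := hx
    rw [canonRes_canonBasis, canonMap_canonBasis he, canonMap_canonBasis he,
      ← Xi.res_res le_top h]
    exact (Xi.map_iterate_aMap (Hol.res (CoordIdx k p → ℂ) h) _ _).symm
  | zero =>
    rw [map_zero, map_zero, map_zero]
    funext i
    simp [Xi.res, Xi.map]
  | add x y _ _ hx hy =>
    rw [map_add, map_add, hx, hy, map_add, Xi.res, Xi.res, Xi.res, Xi.map_add]
  | smul f x _ hx =>
    rw [canonRes_smul, map_smul, map_smul, hx, Xi.res, Xi.res, Xi.map_smul]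
    rfl

/-- A section that is locally a combination of the `a ^ ν φ` has local preimages. Injectivity makes
them agree on overlaps, so they glue in the canonical family: its image is already a sheaf. -/
theorem range_canonMap_eq_genSheaf
    (he : IsTriangularChain (lamSeq lam1 p) (tautSeries ⊤) (k - 1) (tautProd ⊤) d e)
    (V : Opens (paramOpens k p)) :
    LinearMap.range (canonMap lam1 e V) = genSheaf (e (k - 1)) V le_top := by
  apply le_antisymm
  · intro s hs x hx
    refine ⟨V, le_rfl, hx, ?_⟩
    rw [Xi.res_self]
    rwa [range_canonMap_eq_orbitSpan he] at hs
  · intro s hs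
    have hloc : ∀ x : V, ∃ (W : Opens (paramOpens k p)) (h : W ≤ V), (x : paramOpens k p) ∈ W ∧
        ∃ t, canonMap lam1 e W t = Xi.res h s := by
      intro x
      obtain ⟨W, h, hxW, hW⟩ := hs x x.2
      rw [← range_canonMap_eq_orbitSpan he] at hW
      exact ⟨W, h, hxW, hW⟩
    choose W hWV hxW t ht using hloc
    obtain ⟨u, hu⟩ := canon_glue lam1 W t fun x y => canonMap_injective he _ (by
      rw [canonMap_canonRes he, canonMap_canonRes he, ht, ht, Xi.res_res, Xi.res_res])
    have hV : V ≤ iSup W := fun x hx => Opens.mem_iSup.mpr ⟨⟨x, hx⟩, hxW _⟩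
    refine ⟨canonRes lam1 hV u, Xi.separated _ _ fun x hx =>
      ⟨W ⟨x, hx⟩, hWV _, hxW ⟨x, hx⟩, ?_⟩⟩
    rw [← canonMap_canonRes he, canonRes_res, ← ht, hu]

/-- Over open sets and at points alike, the iterates of `a` on the last element span the same module
as the independent chain. At a point, independence follows from the evaluated chain, whose diagonal
stays nonzero. -/
theorem isThematic_of_isTriangularChain
    (he : IsTriangularChain (lamSeq lam1 p) (tautSeries ⊤) (k - 1) (tautProd ⊤) d e) :
    IsThematic (k - 1 + 1) (e (k - 1)) where
  linearIndependent V _ :=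
    linearIndependent_of_span_eq (linearIndependent_res he V)
      ((isTriangularChain_res he V).span_iterate_fin (constantCoeff_tautSeries V))
  span_eq V _ := (range_canonMap he V).symm.trans (range_canonMap_eq_genSheaf he V)
  fibre x := by
    have hx := he.map (Hol.eval (CoordIdx k p → ℂ) x)
    have hS : ∀ j, PowerSeries.constantCoeff (PowerSeries.map (Hol.eval (CoordIdx k p → ℂ) x :
        Hol (CoordIdx k p → ℂ) (⊤ : Opens (paramOpens k p)) →+* ℂ) (tautSeries ⊤ j)) = 1 := by
      intro j
      rw [map_eval_tautSeries, constantCoeff_seriesOf]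
    refine linearIndependent_of_span_eq (hx.linearIndependent fun i hi r hr => ?_)
      (hx.span_iterate_fin hS)
    rw [eval_tautProd] at hr
    exact (mul_eq_zero.mp hr).resolve_right (prod_coeff_seriesOf_ne_zero _ hi)

/-- The canonical family is a holomorphic family of themes. -/
theorem isHolomorphicFamilyOfThemes_canonicalFamily (hk : 1 ≤ k) (hlam : (k : ℚ) - 1 < lam1) :
    IsHolomorphicFamilyOfThemes k (canonicalFamily k lam1 p) := by
  obtain ⟨l, m, hl0, hl1, hm, hlm⟩ := exists_eq_add_natCast hk hlam
  obtain ⟨e, he⟩ := exists_isTriangularChain (lamSeq lam1 p)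
    (tautSeries (⊤ : Opens (paramOpens k p))) (k - 1) l p (shiftSeq m p)
    (fun i hi => shiftSeq_succ_add_one p hm hi) hm
    (fun i hi => lamSeq_eq_add_shiftSeq p hm hlm hi)
  change IsTriangularChain _ _ _ (tautProd ⊤) _ e at he
  have hth := isThematic_of_isTriangularChain he
  rw [Nat.sub_add_cancel hk] at hth
  intro x
  refine ⟨⊤, {l}, e (k - 1), fun V _ => canonMap lam1 e V, trivial, ?_, hth,
    fun V _ => ⟨canonMap_injective he V, range_canonMap_eq_genSheaf he V⟩,
    fun V _ s => canonMap_aAct he V s, fun V W _ h s => canonMap_canonRes he h s⟩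
  intro q hq
  rw [Finset.mem_singleton.mp hq]
  exact ⟨hl0, hl1⟩

end Family

end ABTheme

theorem theorem2p1p2 (k : ℕ) (hk : 1 ≤ k) (lam1 : ℚ) (hlam : (k : ℚ) - 1 < lam1) (p : ℕ → ℕ) :
    (∃ (m n : ℕ) (r : Fin m ⊕ Fin n ≃ ABTheme.CoordIdx k p),
      ∀ s : ABTheme.CoordIdx k p → ℂ,
        s ∈ ABTheme.paramOpens k p ↔ ∀ i : Fin n, s (r (Sum.inr i)) ≠ 0) ∧
    ABTheme.IsABSheaf (ABTheme.canonicalFamily k lam1 p) ∧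
    (∀ σ : ABTheme.paramOpens k p,
      ABTheme.IsPrimitiveTheme lam1 k (ABTheme.canonE lam1 σ)
        (ABTheme.Cyc.aAct (ABTheme.canonP lam1 σ)) ∧
      ABTheme.IsFibre (ABTheme.canonicalFamily k lam1 p) σ (ABTheme.canonE lam1 σ)
        (ABTheme.Cyc.aAct (ABTheme.canonP lam1 σ))) ∧
    ABTheme.IsHolomorphicFamilyOfThemes k (ABTheme.canonicalFamily k lam1 p) :=
  ⟨ABTheme.exists_equiv_mem_paramOpens_iff k p, ABTheme.isABSheaf_canonicalFamily k lam1 p,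
    fun σ => ⟨ABTheme.isPrimitiveTheme_canonE hk hlam σ,
      ABTheme.isFibre_canonicalFamily lam1 σ⟩,
    ABTheme.isHolomorphicFamilyOfThemes_canonicalFamily hk hlam⟩
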